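/- Let $0<p<1$, $q:=1-p$, $Q:=1/q$, $L:=\ln Q$, $\log:=\log_Q$ and $\chi_l:=2l\pi\mathbf i/L$. Consider asymmetric adaptive sampling with a cache for at most $b$ keys ($b$ fixed). Each key is hashed to an infinite string of bits; all bits of all keys are independent, each being $1$ with probability $p$ and $0$ with probability $q$. A stream of data with exactly $n$ distinct keys is read, starting from depth $d=0$ and an empty cache. A key that is read is put into the cache (if it is not yet there) when its hashed value starts with $0^d$; whenever the cache holds more than $b$ keys, $d$ is increased by $1$ and only the keys whose hashed value starts with $0^d$ are kept, and this is repeated until the cache holds at most $b$ keys. Let $D$ be the final depth, $R$ the final number of keys in the cache, and $Z:=RQ^D/n$. Let ${k\brace i}$ be the Stirling numbers of the second kind, and let $f(n)\sim g(n)$ mean $f(n)-g(n)=o(g(n))$ as $n\to\infty$. For every integer $k$ with $1\le k\le b$, $\mathbb E[Z^k]$ is finite and $$\mathbb E[Z^k]\sim m_{1,k}+w_{1,k}(\log n),$$ where the non-periodic component is $$m_{1,k}=1+\frac{(b-k)!}{L}\sum_{i=1}^{k-1}{k\brace i}\frac{q^{i-k}-1}{(k-i)(b-i)!}$$ and the periodic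 component is $$w_{1,k}(x)=\sum_{l\in\mathbb Z,\ l\neq0}\frac1L\sum_{j=1}^{k-1}{k\brace j}\left(1-q^{j-k}\right)\Gamma(j-k+\chi_l)\binom{b-k+\chi_l}{b-j}e^{-2l\pi\mathbf i x}.$$ Here the series converges absolutely for every real $x$, and $w_{1,k}$ is a continuous function of period $1$ with mean value $\int_0^1w_{1,k}(x)\,dx=0$. Moreover, if $b\ge2$, then $Z$ is square-integrable and the non-periodic component of its variance is $\frac{p}{(b-1)qL}$, that is, $$\mathbb V(Z)\sim\frac{p}{(b-1)qL}+w_{1,2}(\log n).$$ -/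

import Mathlib

open MeasureTheory ProbabilityTheory Filter Topology Asymptotics
open scoped BigOperators Nat

namespace AdaptiveSampling

/-- The hashed value `x` (an infinite bit string, `true` being the bit `1`) starts with `0^d`. -/
def StartsWithZeros (x : ℕ → Bool) (d : ℕ) : Prop := ∀ j < d, x j = false

instance (x : ℕ → Bool) (d : ℕ) : Decidable (StartsWithZeros x d) :=
  inferInstanceAs (Decidable (∀ j < d, x j = false))

/-- The keys of the cache `B` that survive filtering at depth `d`. -/
def keep {K : Type*} (h : K → ℕ → Bool) (d : ℕ) (B : Finset K) : Finset K :=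
  B.filter fun x => StartsWithZeros (h x) d

/-- Treatment of an overflow: starting from depth `d`, the depth is increased by one and the cache
is filtered, again and again, until the cache holds at most `b` keys. The value is the first depth
`e ≥ d` at which the filtered cache holds at most `b` keys; it is `d` when there is no overflow.
(If more than `b` keys of the cache were hashed to the string `000…`, there would be no such depth;
the value is then `0`. For random bits this has probability zero.) -/
noncomputable def nextDepth {K : Type*} (b : ℕ) (h : K → ℕ → Bool) (d : ℕ) (B : Finset K) : ℕ :=
  sInf {e | d ≤ e ∧ (keep h e B).card ≤ b}

/-- One step of adaptive sampling. The state is (depth, cache); a datum `x` is inserted in the cache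
if its hashed value starts with `0^depth` (and it is not yet there), and overflow is then treated. -/
noncomputable def step {K : Type*} [DecidableEq K] (b : ℕ) (h : K → ℕ → Bool)
    (s : ℕ × Finset K) (x : K) : ℕ × Finset K :=
  let B := if StartsWithZeros (h x) s.1 then insert x s.2 else s.2
  (nextDepth b h s.1 B, keep h (nextDepth b h s.1 B) B)

/-- The final state on the stream `S`, starting from depth `0` and the empty cache. -/
noncomputable def run {K : Type*} [DecidableEq K] (b : ℕ) (h : K → ℕ → Bool) (S : List K) :
    ℕ × Finset K :=
  S.foldl (step b h) (0, ∅)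

/-- The final depth `D`. -/
noncomputable def finalDepth {K : Type*} [DecidableEq K] (b : ℕ) (h : K → ℕ → Bool)
    (S : List K) : ℕ :=
  (run b h S).1

/-- The final cache size `R`. -/
noncomputable def finalSize {K : Type*} [DecidableEq K] (b : ℕ) (h : K → ℕ → Bool)
    (S : List K) : ℕ :=
  (run b h S).2.card

/-- `Z = R Q ^ D / n`, where `Q = 1 / q` and `n` is the number of distinct keys of the stream. -/
noncomputable def Z {K : Type*} [DecidableEq K] (q : ℝ) (b : ℕ) (h : K → ℕ → Bool)
    (S : List K) : ℝ :=
  (finalSize b h S : ℝ) * (1 / q) ^ finalDepth b h S / (S.toFinset.card : ℝ)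

/-- `L = ln Q`, where `Q = 1 / q`. -/
noncomputable def L (q : ℝ) : ℝ := Real.log (1 / q)

/-- `χ_l = 2 l π i / L`. -/
noncomputable def chi (q : ℝ) (l : ℤ) : ℂ := 2 * l * Real.pi * Complex.I / L q

/-- The non-periodic component
`m_{1,k} = 1 + (b-k)!/L ∑_{i=1}^{k-1} S(k,i) (q^(i-k) - 1) / ((k-i) (b-i)!)`. -/
noncomputable def m (q : ℝ) (b k : ℕ) : ℝ :=
  1 + ((b - k)! : ℝ) / L q * ∑ i ∈ Finset.Ico 1 k,
    (Nat.stirlingSecond k i : ℝ) * ((q ^ ((i : ℤ) - (k : ℤ)) - 1) /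
      (((k : ℝ) - (i : ℝ)) * ((b - i)! : ℝ)))

/-- The summand of index `l` of the periodic component `w_{1,k}`, as a function of `x = log_Q n`. -/
noncomputable def wTerm (q : ℝ) (b k : ℕ) (x : ℝ) (l : ℤ) : ℂ :=
  1 / (L q : ℂ) * (∑ j ∈ Finset.Ico 1 k,
    (Nat.stirlingSecond k j : ℂ) * (1 - (q : ℂ) ^ ((j : ℤ) - (k : ℤ))) *
      Complex.Gamma ((j : ℂ) - (k : ℂ) + chi q l) *
      Ring.choose ((b : ℂ) - (k : ℂ) + chi q l) (b - j)) *
    Complex.exp (-(2 * l * Real.pi * Complex.I * x))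

/-- The periodic component `w_{1,k}`, as a function of `x = log_Q n`: the sum over all `l ≠ 0`. -/
noncomputable def w (q : ℝ) (b k : ℕ) (x : ℝ) : ℂ := ∑' l : {l : ℤ // l ≠ 0}, wTerm q b k x l

end AdaptiveSampling

/-! Almost surely no key of the stream is hashed to `000…`. The final state then depends only on the
set of distinct keys: with N_d the number of keys surviving at depth d, D is the least d with N_d ≤
b, and R = N_D (`run_eq`). For n > b, the indicator of D = e+1 is 1[N_e > b] - 1[N_{e+1} > b].
Expanding R^k in falling factorials with Stirling numbers and using that a falling factorial counts
surviving j-subsets, one gets exact moments (`integral_Z_pow`) in terms of the series `depthSum`,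
the sum over d of Q^{rd} P(Bin(n-j, q^d) > c) with r = k-j and c = b-j.

Divided by n^r, this series is a sum over the lattice ℤ - log_Q n of values that approach those of
the Poisson profile `layer`. Dominated convergence, after recentring at the integer part of log_Q n,
makes it asymptotic to `periodSum`, a function of log_Q n of period 1
(`tendsto_depthSum_sub_periodSum`). Poisson summation (`hasSum_layerCoeff`) gives its Fourier
series; the coefficients are values at -r + χ_l of the Mellin transform of the Poisson tail, which
integration by parts reduces to a Gamma function (`mellin_poissonTail`). The coefficient l = 0
yields m, the others yield w (`m_add_w`).

All differences tend to 0; since the limits stay above a positive constant, this upgrades to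
asymptotic equivalence. For the variance, E[Z] → 1, and the second-moment limit minus 1 is a
positive multiple of a `periodSum`. -/

namespace AdaptiveSampling

/-! ### Deterministic description of the final state -/

section Paths

variable {K : Type*}

lemma StartsWithZeros.mono {x : ℕ → Bool} {d e : ℕ} (hde : d ≤ e) (h : StartsWithZeros x e) :
    StartsWithZeros x d := fun j hj => h j (hj.trans_le hde)

lemma keep_keep (h : K → ℕ → Bool) {d e : ℕ} (hde : d ≤ e) (B : Finset K) :
    keep h e (keep h d B) = keep h e B := by
  ext x
  simp only [keep, Finset.mem_filter]
  exact ⟨fun hx => ⟨hx.1.1, hx.2⟩, fun hx => ⟨⟨hx.1, hx.2.mono hde⟩, hx.2⟩⟩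

lemma keep_subset_keep (h : K → ℕ → Bool) {d e : ℕ} (hde : d ≤ e) (B : Finset K) :
    keep h e B ⊆ keep h d B :=
  Finset.monotone_filter_right _ fun _ _ hx => StartsWithZeros.mono hde hx

lemma keep_mono (h : K → ℕ → Bool) (d : ℕ) {A B : Finset K} (hAB : A ⊆ B) :
    keep h d A ⊆ keep h d B :=
  Finset.filter_subset_filter _ hAB

@[simp] lemma keep_zero (h : K → ℕ → Bool) (B : Finset K) : keep h 0 B = B :=
  Finset.filter_true_of_mem fun _ _ j hj => absurd hj (Nat.not_lt_zero j)

/-- The depth that a set of keys forces: the first one at which at most `b` of them survive. -/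
noncomputable def depth (b : ℕ) (h : K → ℕ → Bool) (B : Finset K) : ℕ :=
  sInf {e | (keep h e B).card ≤ b}

lemma exists_keep_eq_empty (h : K → ℕ → Bool) (B : Finset K) (hB : ∀ x ∈ B, ∃ j, h x j = true) :
    ∃ e, keep h e B = ∅ := by
  choose! j hj using hB
  refine ⟨B.sup j + 1, Finset.filter_eq_empty_iff.2 fun x hx hz => ?_⟩
  have := hz (j x) (Nat.lt_succ_of_le (Finset.le_sup hx))
  simp [hj x hx] at this

/-- Survivors decrease with the depth, so the admissible depths form an up-set. The bit `true` in
each hashed value makes this set nonempty, which excludes the default value `sInf ∅ = 0`. -/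
lemma card_keep_le_iff (b : ℕ) (h : K → ℕ → Bool) (B : Finset K)
    (hB : ∀ x ∈ B, ∃ j, h x j = true) (e : ℕ) : (keep h e B).card ≤ b ↔ depth b h B ≤ e := by
  constructor
  · exact fun he => Nat.sInf_le he
  · intro he
    obtain ⟨e₀, he₀⟩ := exists_keep_eq_empty h B hB
    have hm : depth b h B ∈ {e | (keep h e B).card ≤ b} :=
      Nat.sInf_mem ⟨e₀, by simp [he₀]⟩
    exact (Finset.card_le_card (keep_subset_keep h he B)).trans hm

variable [DecidableEq K]

/-- Induction on the last datum. Filtering at D commutes with inserting the new key, and a larger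
set of keys forces a larger depth, so nothing discarded earlier could have survived later. -/
lemma run_eq (b : ℕ) (h : K → ℕ → Bool) (S : List K) (hS : ∀ x ∈ S, ∃ j, h x j = true) :
    run b h S = (depth b h S.toFinset, keep h (depth b h S.toFinset) S.toFinset) := by
  induction S using List.reverseRecOn with
  | nil =>
    have : depth b h (∅ : Finset K) = 0 :=
      Nat.le_zero.1 (Nat.sInf_le (by simp [keep]))
    simp [run, this]
  | append_singleton S x ih =>
    have hS' : ∀ y ∈ S, ∃ j, h y j = true := fun y hy => hS y (by simp [hy])
    have hT : (S ++ [x]).toFinset = insert x S.toFinset := by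
      ext y; simp
    have hTx : ∀ y ∈ insert x S.toFinset, ∃ j, h y j = true := fun y hy => by
      rw [← hT] at hy; exact hS y (List.mem_toFinset.1 hy)
    have hSx : ∀ y ∈ S.toFinset, ∃ j, h y j = true := fun y hy => hS' y (List.mem_toFinset.1 hy)
    rw [run, List.foldl_append, ← run, ih hS', hT, List.foldl_cons, List.foldl_nil]
    set D := depth b h S.toFinset
    have hB : (if StartsWithZeros (h x) D then insert x (keep h D S.toFinset)
        else keep h D S.toFinset) = keep h D (insert x S.toFinset) := by
      simp only [keep, Finset.filter_insert]
    have hDle : D ≤ depth b h (insert x S.toFinset) := by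
      rw [← card_keep_le_iff b h _ hSx]
      exact (Finset.card_le_card (keep_mono h _ (Finset.subset_insert _ _))).trans
        ((card_keep_le_iff b h _ hTx _).2 le_rfl)
    have hnext : nextDepth b h D (keep h D (insert x S.toFinset))
        = depth b h (insert x S.toFinset) := by
      refine le_antisymm (Nat.sInf_le ⟨hDle, ?_⟩) (le_csInf ⟨_, hDle, ?_⟩ ?_)
      · rw [keep_keep h hDle]; exact (card_keep_le_iff b h _ hTx _).2 le_rfl
      · rw [keep_keep h hDle]; exact (card_keep_le_iff b h _ hTx _).2 le_rfl
      · rintro e ⟨he, hc⟩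
        rw [keep_keep h he] at hc
        exact (card_keep_le_iff b h _ hTx _).1 hc
    simp only [step, hB, hnext, keep_keep h hDle]

lemma Z_eq (q : ℝ) (b : ℕ) (h : K → ℕ → Bool) (S : List K) (hS : ∀ x ∈ S, ∃ j, h x j = true) :
    Z q b h S = ((keep h (depth b h S.toFinset) S.toFinset).card : ℝ) *
      (1 / q) ^ depth b h S.toFinset / (S.toFinset.card : ℝ) := by
  rw [Z, finalSize, finalDepth, run_eq b h S hS]

omit [DecidableEq K] in
/-- If more than `b` keys are present, a function of the final depth and the final size is the sum
of its values on the layers `D = e + 1`. -/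
lemma hasSum_layers (b : ℕ) (h : K → ℕ → Bool) (B : Finset K)
    (hB : ∀ x ∈ B, ∃ j, h x j = true) (hb : b < B.card) (g : ℕ → ℕ → ℝ) :
    HasSum (fun e : ℕ => g (e + 1) (keep h (e + 1) B).card *
      ((if b < (keep h e B).card then 1 else 0) - if b < (keep h (e + 1) B).card then 1 else 0))
      (g (depth b h B) (keep h (depth b h B) B).card) := by
  have hiff : ∀ e, b < (keep h e B).card ↔ e < depth b h B := fun e => by
    rw [← not_le, card_keep_le_iff b h B hB, not_le]
  -- With more than b keys at depth 0 the final depth is positive, so exactly one layer, e = D - 1,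
  -- contributes.
  have hpos : 0 < depth b h B := (hiff 0).1 (by simpa using hb)
  obtain ⟨d, hd⟩ : ∃ d, depth b h B = d + 1 := ⟨depth b h B - 1, by omega⟩
  simp only [hiff, hd]
  have := hasSum_single (f := fun e : ℕ => g (e + 1) (keep h (e + 1) B).card *
      ((if e < d + 1 then (1 : ℝ) else 0) - if e + 1 < d + 1 then 1 else 0)) d (by
    intro e he
    rcases lt_or_gt_of_ne he with h1 | h1
    · rw [if_pos (by omega), if_pos (by omega)]; simp
    · rw [if_neg (by omega), if_neg (by omega)]; simp)
  simpa using this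

end Paths

/-- Multiplying a falling factorial of order j by N = (N - j) + j produces the Stirling recurrence.
-/
lemma pow_eq_sum_stirlingSecond (N k : ℕ) :
    N ^ k = ∑ j ∈ Finset.range (k + 1), Nat.stirlingSecond k j * N.descFactorial j := by
  induction k with
  | zero => simp
  | succ k ih =>
    have hstep : ∀ j, N * N.descFactorial j = N.descFactorial (j + 1) + j * N.descFactorial j := by
      intro j
      rw [Nat.descFactorial_succ, ← add_mul]
      rcases le_or_gt j N with h | h
      · rw [Nat.sub_add_cancel h]
      · simp [Nat.descFactorial_eq_zero_iff_lt.2 h]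
    rw [pow_succ, ih, Finset.sum_mul, Finset.sum_range_succ' _ (k + 1)]
    simp only [Nat.stirlingSecond_succ_succ, Nat.stirlingSecond_succ_zero, zero_mul, add_zero,
      add_mul _ (Nat.stirlingSecond k _) (Nat.descFactorial _ _), Finset.sum_add_distrib]
    have h0 : ∑ j ∈ Finset.range (k + 1), (j + 1) * Nat.stirlingSecond k (j + 1) *
        N.descFactorial (j + 1) = ∑ j ∈ Finset.range (k + 1), j * Nat.stirlingSecond k j *
        N.descFactorial j := by
      have h1 := Finset.sum_range_succ (fun j => j * Nat.stirlingSecond k j * N.descFactorial j)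
        (k + 1)
      have h2 := Finset.sum_range_succ' (fun j => j * Nat.stirlingSecond k j * N.descFactorial j)
        (k + 1)
      rw [Nat.stirlingSecond_eq_zero_of_lt (Nat.lt_succ_self k)] at h1
      simp only [zero_mul, mul_zero, add_zero] at h1 h2
      rw [← h1, h2]
    rw [h0, ← Finset.sum_add_distrib]
    refine Finset.sum_congr rfl fun j _ => ?_
    rw [mul_assoc, mul_comm _ N, hstep]
    ring

/-! ### Joint law of the surviving keys -/

section Law

variable {Ω : Type*} [MeasurableSpace Ω] {μ : Measure Ω} [IsProbabilityMeasure μ]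
  {K : Type*} [DecidableEq K] {p q : ℝ} {H : K → ℕ → Ω → Bool}

omit [DecidableEq K] in
lemma measurableSet_startsWithZeros (hmeas : ∀ x j, Measurable (H x j)) (x : K) (d : ℕ) :
    MeasurableSet {ω | StartsWithZeros (fun j => H x j ω) d} := by
  have : {ω | StartsWithZeros (fun j => H x j ω) d} = ⋂ j < d, H x j ⁻¹' {false} := by
    ext ω; simp [StartsWithZeros]
  rw [this]
  exact MeasurableSet.iInter fun j => MeasurableSet.iInter fun _ => hmeas x j trivial

omit [DecidableEq K] in
lemma measureReal_startsWithZeros (hp0 : 0 < p) (hq : q = 1 - p)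
    (hmeas : ∀ x j, Measurable (H x j)) (hindep : iIndepFun (fun i : K × ℕ => H i.1 i.2) μ)
    (hlaw : ∀ x j, μ {ω | H x j ω = true} = ENNReal.ofReal p) (x : K) (d : ℕ) :
    μ.real {ω | StartsWithZeros (fun j => H x j ω) d} = q ^ d := by
  have hfalse : ∀ j, μ.real (H x j ⁻¹' {false}) = q := by
    intro j
    have h1 : H x j ⁻¹' {false} = {ω | H x j ω = true}ᶜ := by ext ω; simp
    have h2 : MeasurableSet {ω | H x j ω = true} := hmeas x j (MeasurableSet.singleton true)
    rw [h1, probReal_compl_eq_one_sub h2, Measure.real, hlaw, ENNReal.toReal_ofReal hp0.le, hq]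
  have h3 : {ω | StartsWithZeros (fun j => H x j ω) d} =
      ⋂ i ∈ (Finset.range d).map ⟨fun j => (x, j), Prod.mk_right_injective x⟩,
        (fun i : K × ℕ => H i.1 i.2) i ⁻¹' {false} := by
    ext ω
    simp [StartsWithZeros]
  rw [h3, Measure.real, hindep.measure_inter_preimage_eq_mul _
    (fun i _ => MeasurableSet.singleton false), ENNReal.toReal_prod, Finset.prod_map]
  simp only [Function.Embedding.coeFn_mk]
  rw [← Finset.card_range d, ← Finset.prod_const]
  simp only [Finset.card_range]
  exact Finset.prod_congr rfl fun j _ => hfalse j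

/-- Distinct keys are hashed independently. -/
lemma measureReal_forall_startsWithZeros_iff (hp0 : 0 < p) (hq : q = 1 - p)
    (hmeas : ∀ x j, Measurable (H x j)) (hindep : iIndepFun (fun i : K × ℕ => H i.1 i.2) μ)
    (hlaw : ∀ x j, μ {ω | H x j ω = true} = ENNReal.ofReal p) (d : K → ℕ) (T S : Finset K) :
    μ.real {ω | ∀ x ∈ S, (StartsWithZeros (fun j => H x j ω) (d x) ↔ x ∈ T)} =
      ∏ x ∈ S, if x ∈ T then q ^ d x else 1 - q ^ d x := by
  induction S using Finset.induction_on with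
  | empty => simp
  | insert a S ha ih =>
    -- Beyond depth M no bit matters: the events for `a` and for `S` depend on two disjoint finite
    -- blocks of bits, and every set of values of such a block is measurable.
    set M := (insert a S).sup d with hM
    have hdM : ∀ x ∈ insert a S, d x ≤ M := fun x hx => Finset.le_sup hx
    have hdisj : Disjoint (({a} : Finset K) ×ˢ Finset.range M) (S ×ˢ Finset.range M) := by
      rw [Finset.disjoint_left]
      rintro ⟨y, j⟩ h1 h2
      simp only [Finset.mem_product, Finset.mem_singleton] at h1 h2
      exact ha (h1.1 ▸ h2.1)
    have hI := hindep.indepFun_finset _ _ hdisj fun i => hmeas i.1 i.2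
    have hA : {ω | StartsWithZeros (fun j => H a j ω) (d a) ↔ a ∈ T} =
        (fun ω (i : (({a} : Finset K) ×ˢ Finset.range M : Finset (K × ℕ))) =>
          H i.1.1 i.1.2 ω) ⁻¹'
        {f | (∀ i : (({a} : Finset K) ×ˢ Finset.range M : Finset (K × ℕ)),
          i.1.2 < d a → f i = false) ↔ a ∈ T} := by
      ext ω
      simp only [Set.mem_ofPred_eq, Set.mem_preimage]
      refine iff_congr ⟨fun h i hi => ?_, fun h j hj => ?_⟩ Iff.rfl
      · have : i.1.1 = a := by
          have := i.2; simp only [Finset.mem_product, Finset.mem_singleton] at this; exact this.1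
        rw [this]; exact h _ hi
      · exact h ⟨(a, j), by
          simpa using hj.trans_le (hdM a (Finset.mem_insert_self _ _))⟩ hj
    have hB : {ω | ∀ x ∈ S, (StartsWithZeros (fun j => H x j ω) (d x) ↔ x ∈ T)} =
        (fun ω (i : (S ×ˢ Finset.range M : Finset (K × ℕ))) => H i.1.1 i.1.2 ω) ⁻¹'
        {f | ∀ x ∈ S, ((∀ i : (S ×ˢ Finset.range M : Finset (K × ℕ)),
          i.1.1 = x → i.1.2 < d x → f i = false) ↔ x ∈ T)} := by
      ext ω
      simp only [Set.mem_ofPred_eq, Set.mem_preimage]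
      refine forall₂_congr fun x hx => iff_congr ⟨fun h i hi hj => ?_, fun h j hj => ?_⟩ Iff.rfl
      · rw [hi]; exact h _ hj
      · exact h ⟨(x, j), by
          simpa [hx] using hj.trans_le (hdM x (Finset.mem_insert_of_mem hx))⟩ rfl hj
    have hAB : {ω | ∀ x ∈ insert a S, (StartsWithZeros (fun j => H x j ω) (d x) ↔ x ∈ T)} =
        {ω | StartsWithZeros (fun j => H a j ω) (d a) ↔ a ∈ T} ∩
        {ω | ∀ x ∈ S, (StartsWithZeros (fun j => H x j ω) (d x) ↔ x ∈ T)} := by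
      ext ω
      simp
    have hone : μ.real {ω | StartsWithZeros (fun j => H a j ω) (d a) ↔ a ∈ T} =
        if a ∈ T then q ^ d a else 1 - q ^ d a := by
      split_ifs with haT
      · simpa [haT] using measureReal_startsWithZeros hp0 hq hmeas hindep hlaw a (d a)
      · have h1 : {ω | StartsWithZeros (fun j => H a j ω) (d a) ↔ a ∈ T} =
            {ω | StartsWithZeros (fun j => H a j ω) (d a)}ᶜ := by ext ω; simp [haT]
        rw [h1, probReal_compl_eq_one_sub (measurableSet_startsWithZeros hmeas a _),
          measureReal_startsWithZeros hp0 hq hmeas hindep hlaw]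
    rw [Finset.prod_insert ha, ← ih, ← hone, hAB, hA, hB, Measure.real,
      hI.measure_inter_preimage_eq_mul _ _ (Set.toFinite _).measurableSet
        (Set.toFinite _).measurableSet, ENNReal.toReal_mul]
    rfl

/-- `P(X > c)` for a binomial variable `X` with parameters `N` and `y`. -/
noncomputable def binTail (N c : ℕ) (y : ℝ) : ℝ :=
  ∑ i ∈ Finset.range (N + 1), if c < i then (N.choose i : ℝ) * y ^ i * (1 - y) ^ (N - i) else 0

/-- If J survives to depth d ≥ e it also survives at depth e, so overflow at e means that more than
b - |J| of the other keys survive there, an independent binomial event. The event is split according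
to the exact set T of these other survivors. -/
lemma measureReal_subset_keep (hp0 : 0 < p) (hq : q = 1 - p)
    (hmeas : ∀ x j, Measurable (H x j)) (hindep : iIndepFun (fun i : K × ℕ => H i.1 i.2) μ)
    (hlaw : ∀ x j, μ {ω | H x j ω = true} = ENNReal.ofReal p) {S J : Finset K} (hJ : J ⊆ S)
    {b : ℕ} (hb : J.card ≤ b) {e d : ℕ} (hed : e ≤ d) :
    μ.real {ω | J ⊆ keep (fun x j => H x j ω) d S ∧ b < (keep (fun x j => H x j ω) e S).card} =
      q ^ (d * J.card) * binTail (S.card - J.card) (b - J.card) (q ^ e) := by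
  -- Keys of J are tested at depth d, all others at depth e.
  set δ : K → ℕ := fun x => if x ∈ J then d else e with hδ
  set E : Finset K → Set Ω := fun T =>
    {ω | ∀ x ∈ S, (StartsWithZeros (fun j => H x j ω) (δ x) ↔ x ∈ J ∪ T)} with hE
  have hEm : ∀ T, MeasurableSet (E T) := by
    intro T
    have : E T = ⋂ x ∈ S, {ω | StartsWithZeros (fun j => H x j ω) (δ x) ↔ x ∈ J ∪ T} := by
      ext ω; simp [hE]
    rw [this]
    refine Finset.measurableSet_biInter _ fun x _ => ?_
    exact (measurableSet_startsWithZeros hmeas x _).iff (MeasurableSet.const _)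
  have hEJ : ∀ ω, J ⊆ keep (fun x j => H x j ω) d S →
      (keep (fun x j => H x j ω) e S).card =
        J.card + (keep (fun x j => H x j ω) e (S \ J)).card := by
    intro ω hω
    rw [← Finset.card_union_of_disjoint]
    · congr 1
      ext x
      have := @hω x
      simp only [keep, Finset.mem_filter, Finset.mem_union, Finset.mem_sdiff] at this ⊢
      constructor
      · rintro ⟨h1, h2⟩; by_cases hx : x ∈ J <;> simp [*]
      · rintro (h1 | h1)
        · exact ⟨hJ h1, (this h1).2.mono hed⟩
        · exact ⟨h1.1.1, h1.2⟩
    · rw [Finset.disjoint_left]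
      intro x hx hx'
      simp [keep, hx] at hx'
  have hmemE : ∀ ω, ∀ T ∈ (S \ J).powerset, ω ∈ E T ↔
      J ⊆ keep (fun x j => H x j ω) d S ∧ keep (fun x j => H x j ω) e (S \ J) = T := by
    intro ω T hT
    rw [Finset.mem_powerset] at hT
    simp only [hE, hδ, Set.mem_ofPred_eq, keep, Finset.subset_iff, Finset.ext_iff,
      Finset.mem_filter, Finset.mem_sdiff, Finset.mem_union]
    constructor
    · intro h
      refine ⟨fun x hx => ⟨hJ hx, by simpa [hx] using h x (hJ hx)⟩, fun x => ⟨?_, fun hx => ?_⟩⟩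
      · rintro ⟨⟨h1, h2⟩, h3⟩
        have := h x h1
        simp only [h2, if_false, false_or] at this
        exact this.1 h3
      · have h1 := Finset.mem_sdiff.1 (hT hx)
        have := h x h1.1
        simp only [h1.2, if_false, false_or] at this
        exact ⟨h1, this.2 hx⟩
    · rintro ⟨h1, h2⟩ x hx
      by_cases hxJ : x ∈ J
      · simpa [hxJ] using (h1 hxJ).2
      · have := h2 x
        simp only [hx, hxJ, not_false_eq_true, and_self, true_and] at this
        simpa [hxJ] using this
  have hset : {ω | J ⊆ keep (fun x j => H x j ω) d S ∧
      b < (keep (fun x j => H x j ω) e S).card} =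
      ⋃ T ∈ (S \ J).powerset.filter (fun T => b - J.card < T.card), E T := by
    ext ω
    simp only [Set.mem_ofPred_eq, Set.mem_iUnion, Finset.mem_filter, exists_prop]
    constructor
    · rintro ⟨h1, h2⟩
      rw [hEJ ω h1] at h2
      have hT : keep (fun x j => H x j ω) e (S \ J) ∈ (S \ J).powerset :=
        Finset.mem_powerset.2 (Finset.filter_subset _ _)
      exact ⟨_, ⟨hT, by omega⟩, (hmemE ω _ hT).2 ⟨h1, rfl⟩⟩
    · rintro ⟨T, ⟨hT, hc⟩, hω⟩
      obtain ⟨h1, h2⟩ := (hmemE ω T hT).1 hω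
      refine ⟨h1, ?_⟩
      rw [hEJ ω h1, h2]
      omega
  have hdisj : Set.PairwiseDisjoint
      (↑((S \ J).powerset.filter (fun T => b - J.card < T.card)) : Set (Finset K)) E := by
    intro T hT T' hT' hne
    rw [Function.onFun, Set.disjoint_left]
    intro ω h1 h2
    rw [Finset.mem_coe, Finset.mem_filter] at hT hT'
    exact hne (((hmemE ω T hT.1).1 h1).2.symm.trans ((hmemE ω T' hT'.1).1 h2).2)
  have hPE : ∀ T ∈ (S \ J).powerset, μ.real (E T) = q ^ (d * J.card) *
      ((q ^ e) ^ T.card * (1 - q ^ e) ^ ((S \ J).card - T.card)) := by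
    intro T hT
    rw [Finset.mem_powerset] at hT
    rw [hE, measureReal_forall_startsWithZeros_iff hp0 hq hmeas hindep hlaw δ (J ∪ T) S,
      ← Finset.union_sdiff_of_subset hJ, Finset.prod_union Finset.disjoint_sdiff]
    congr 1
    · rw [pow_mul, ← Finset.prod_const]
      exact Finset.prod_congr rfl fun x hx => by simp [hδ, hx]
    · rw [← Finset.union_sdiff_of_subset hT, Finset.prod_union Finset.disjoint_sdiff]
      congr 1
      · rw [← Finset.prod_const]
        refine Finset.prod_congr rfl fun x hx => ?_
        have := (Finset.mem_sdiff.1 (hT hx)).2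
        simp [hδ, hx, this]
      · have hc : (J ∪ (T ∪ (S \ J) \ T)) \ J = S \ J := by
          rw [Finset.union_sdiff_of_subset hT, Finset.union_sdiff_of_subset hJ]
        rw [hc, ← Finset.card_sdiff_of_subset hT, ← Finset.prod_const]
        refine Finset.prod_congr rfl fun x hx => ?_
        rw [Finset.mem_sdiff, Finset.mem_sdiff] at hx
        simp [hδ, hx.1.2, hx.2]
  rw [hset, measureReal_biUnion_finset hdisj (fun T _ => hEm T), Finset.sum_filter,
    binTail, ← Finset.card_sdiff_of_subset hJ, Finset.mul_sum]
  have h1 := Finset.sum_powerset_apply_card (fun i => if b - J.card < i then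
    q ^ (d * J.card) * ((q ^ e) ^ i * (1 - q ^ e) ^ ((S \ J).card - i)) else 0) (x := S \ J)
  refine (Finset.sum_congr rfl fun T hT => ?_).trans (h1.trans ?_)
  · split_ifs
    · exact hPE T hT
    · rfl
  · refine Finset.sum_congr rfl fun i _ => ?_
    split_ifs
    · rw [nsmul_eq_mul]; ring
    · simp

end Law

/-! ### Binomial tails and the series over depths -/

section Binomial

lemma binTail_nonneg (N c : ℕ) {y : ℝ} (h0 : 0 ≤ y) (h1 : y ≤ 1) : 0 ≤ binTail N c y := by
  refine Finset.sum_nonneg fun i _ => ?_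
  have : 0 ≤ 1 - y := by linarith
  split_ifs <;> positivity

lemma sum_choose_mul_pow_mul_pow (N : ℕ) (y : ℝ) :
    ∑ i ∈ Finset.range (N + 1), (N.choose i : ℝ) * y ^ i * (1 - y) ^ (N - i) = 1 := by
  calc _ = ∑ i ∈ Finset.range (N + 1), y ^ i * (1 - y) ^ (N - i) * (N.choose i : ℝ) :=
        Finset.sum_congr rfl fun i _ => by ring
    _ = (y + (1 - y)) ^ N := (add_pow y (1 - y) N).symm
    _ = 1 := by simp

lemma binTail_eq_one_sub (N c : ℕ) (hcN : c ≤ N) (y : ℝ) :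
    binTail N c y =
      1 - ∑ i ∈ Finset.range (c + 1), (N.choose i : ℝ) * y ^ i * (1 - y) ^ (N - i) := by
  have h2 : ∑ i ∈ Finset.range (c + 1), (N.choose i : ℝ) * y ^ i * (1 - y) ^ (N - i) =
      ∑ i ∈ Finset.range (N + 1),
        if c < i then 0 else (N.choose i : ℝ) * y ^ i * (1 - y) ^ (N - i) := by
    refine (Finset.sum_congr rfl fun i hi => ?_).trans (Finset.sum_subset
      (Finset.range_subset_range.2 (by omega)) fun i hi hi' => if_pos ?_)
    · rw [if_neg (by have := Finset.mem_range.1 hi; omega)]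
    · have := Finset.mem_range.not.1 hi'
      omega
  rw [binTail, h2, eq_sub_iff_add_eq, ← Finset.sum_add_distrib]
  conv_rhs => rw [← sum_choose_mul_pow_mul_pow N y]
  refine Finset.sum_congr rfl fun i _ => ?_
  split_ifs <;> simp

lemma binTail_le_one (N c : ℕ) {y : ℝ} (h0 : 0 ≤ y) (h1 : y ≤ 1) : binTail N c y ≤ 1 := by
  rcases le_or_gt c N with h | h
  · rw [binTail_eq_one_sub N c h]
    have : 0 ≤ ∑ i ∈ Finset.range (c + 1), (N.choose i : ℝ) * y ^ i * (1 - y) ^ (N - i) :=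
      Finset.sum_nonneg fun i _ => by
        have : 0 ≤ 1 - y := by linarith
        positivity
    linarith
  · rw [binTail, Finset.sum_eq_zero]
    · norm_num
    · intro i hi
      rw [if_neg]
      have := Finset.mem_range.1 hi
      omega

lemma binTail_one {N c : ℕ} (h : c < N) : binTail N c 1 = 1 := by
  rw [binTail_eq_one_sub N c h.le, Finset.sum_eq_zero, sub_zero]
  intro i hi
  have : N - i ≠ 0 := by have := Finset.mem_range.1 hi; omega
  simp [this]

/-- Union bound over the (c+1)-subsets of trials that all succeed; their number is at most N^(c+1).
-/
lemma binTail_le_pow (N c : ℕ) {y : ℝ} (h0 : 0 ≤ y) (h1 : y ≤ 1) :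
    binTail N c y ≤ (N * y) ^ (c + 1) := by
  have hy : 0 ≤ 1 - y := by linarith
  rcases le_or_gt N c with h | h
  · rw [binTail, Finset.sum_eq_zero]
    · positivity
    · intro i hi
      rw [if_neg]
      have := Finset.mem_range.1 hi
      omega
  · obtain ⟨M, rfl⟩ : ∃ M, N = M + (c + 1) := ⟨N - (c + 1), by omega⟩
    have hle : binTail (M + (c + 1)) c y ≤ ((M + (c + 1)).choose (c + 1) : ℝ) * y ^ (c + 1) *
        ∑ i ∈ Finset.range (M + 1), (M.choose i : ℝ) * y ^ i * (1 - y) ^ (M - i) := by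
      rw [binTail, add_right_comm M, add_comm (M + 1), Finset.sum_range_add, Finset.sum_eq_zero,
        zero_add, Finset.mul_sum]
      · refine Finset.sum_le_sum fun i hi => ?_
        rw [if_pos (by omega)]
        have h2 : ((M + (c + 1)).choose (c + 1 + i) : ℝ) ≤
            ((M + (c + 1)).choose (c + 1) : ℝ) * (M.choose i : ℝ) := by
          have h3 := Nat.choose_mul (n := M + (c + 1)) (k := c + 1 + i) (s := c + 1)
            (by omega)
          rw [Nat.add_sub_cancel, Nat.add_sub_cancel_left] at h3
          have h4 : 0 < (c + 1 + i).choose (c + 1) := Nat.choose_pos (by omega)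
          exact_mod_cast (Nat.le_mul_of_pos_right _ h4).trans_eq h3
        have h5 : M + (c + 1) - (c + 1 + i) = M - i := by omega
        rw [h5]
        calc _ ≤ ((M + (c + 1)).choose (c + 1) : ℝ) * (M.choose i : ℝ) * y ^ (c + 1 + i) *
              (1 - y) ^ (M - i) := by gcongr
          _ = _ := by ring
      · intro i hi
        rw [if_neg]
        have := Finset.mem_range.1 hi
        omega
    rw [sum_choose_mul_pow_mul_pow, mul_one] at hle
    refine hle.trans ?_
    rw [mul_pow]
    gcongr
    exact_mod_cast Nat.choose_le_pow _ _

/-- The series that governs the `j`-th factorial moment. -/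
noncomputable def depthSum (q : ℝ) (r N c : ℕ) : ℝ :=
  ∑' d : ℕ, (1 / q) ^ (r * d) * binTail N c (q ^ d)

/-- The tail is O(q^{(c+1)d}), which beats Q^{rd} by at least a factor q^d because r ≤ c. -/
lemma summable_depthSum {q : ℝ} (hq0 : 0 < q) (hq1 : q < 1) {r c : ℕ} (hr : r ≤ c) (N : ℕ) :
    Summable fun d : ℕ => (1 / q) ^ (r * d) * binTail N c (q ^ d) := by
  have hg : Summable fun d : ℕ => (N : ℝ) ^ (c + 1) * q ^ d :=
    (summable_geometric_of_lt_one hq0.le hq1).mul_left _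
  refine Summable.of_nonneg_of_le (fun d => ?_) (fun d => ?_) hg
  · exact mul_nonneg (by positivity)
      (binTail_nonneg _ _ (by positivity) (pow_le_one₀ hq0.le hq1.le))
  · have h1 := binTail_le_pow N c (y := q ^ d) (by positivity) (pow_le_one₀ hq0.le hq1.le)
    obtain ⟨t, rfl⟩ := Nat.exists_eq_add_of_le hr
    calc (1 / q) ^ (r * d) * binTail N (r + t) (q ^ d)
        ≤ (1 / q) ^ (r * d) * (N * q ^ d) ^ (r + t + 1) := by gcongr
      _ = (N : ℝ) ^ (r + t + 1) * (((1 / q) * q) ^ (r * d) * (q ^ d * q ^ (d * t))) := by ring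
      _ = (N : ℝ) ^ (r + t + 1) * (q ^ d * q ^ (d * t)) := by
        rw [one_div_mul_cancel hq0.ne', one_pow, one_mul]
      _ ≤ (N : ℝ) ^ (r + t + 1) * (q ^ d * 1) := by
        gcongr
        exact pow_le_one₀ hq0.le hq1.le
      _ = _ := by rw [mul_one]

/-- Summation by parts: with f(d) = Q^{(k-j)d} P(X > b-j) for X binomial (n-j, q^d), the summand is
Q^{k-j} f(e) - f(e+1). The final +1 is f(0), equal to 1 because b < n. -/
lemma hasSum_binTail_sub {q : ℝ} (hq0 : 0 < q) (hq1 : q < 1) {j k b n : ℕ} (hjk : j ≤ k)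
    (hkb : k ≤ b) (hbn : b < n) :
    HasSum (fun e : ℕ => (1 / q) ^ (k * (e + 1)) * (q ^ ((e + 1) * j) *
      (binTail (n - j) (b - j) (q ^ e) - binTail (n - j) (b - j) (q ^ (e + 1)))))
      (((1 / q) ^ (k - j) - 1) * depthSum q (k - j) (n - j) (b - j) + 1) := by
  have hs := summable_depthSum hq0 hq1 (r := k - j) (c := b - j) (by omega) (n - j)
  set f : ℕ → ℝ := fun d => (1 / q) ^ ((k - j) * d) * binTail (n - j) (b - j) (q ^ d) with hf
  have h0 : f 0 = 1 := by simp [hf, binTail_one (show b - j < n - j by omega)]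
  have h1 : HasSum f (depthSum q (k - j) (n - j) (b - j)) := hs.hasSum
  have h2 : HasSum (fun e => f (e + 1)) (depthSum q (k - j) (n - j) (b - j) - 1) := by
    rw [hasSum_nat_add_iff' 1 (f := f) |>.symm] at h1
    simpa [h0] using h1
  have h3 := (h1.mul_left ((1 / q) ^ (k - j))).sub h2
  obtain ⟨t, rfl⟩ := Nat.exists_eq_add_of_le hjk
  convert! h3 using 1
  · ext e
    simp only [hf, Nat.add_sub_cancel_left]
    have : (1 / q) ^ ((j + t) * (e + 1)) * q ^ ((e + 1) * j) = (1 / q) ^ (t * (e + 1)) := by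
      rw [add_mul, pow_add, mul_comm (e + 1) j, mul_right_comm, ← mul_pow,
        one_div_mul_cancel hq0.ne', one_pow, one_mul]
    rw [← mul_assoc, this]
    ring
  · ring

end Binomial

/-! ### Exact moments of the estimator -/

section Moments

/-- Term-by-term integration of a nonnegative series; finiteness of the sum of the integrals yields
integrability of the limit. -/
lemma integrable_and_integral_eq_of_hasSum {Ω : Type*} [MeasurableSpace Ω] {μ : Measure Ω}
    {F : ℕ → Ω → ℝ} {f : Ω → ℝ} {s : ℝ} (hF : ∀ e, Integrable (F e) μ) (hF0 : ∀ e ω, 0 ≤ F e ω)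
    (hf : ∀ᵐ ω ∂μ, HasSum (fun e => F e ω) (f ω)) (hs : HasSum (fun e => ∫ ω, F e ω ∂μ) s) :
    Integrable f μ ∧ ∫ ω, f ω ∂μ = s := by
  have hmeas : AEStronglyMeasurable f μ := by
    refine aestronglyMeasurable_of_tendsto_ae atTop
      (f := fun n ω => ∑ e ∈ Finset.range n, F e ω) (fun n => ?_) ?_
    · exact (integrable_finsetSum _ fun e _ => hF e).aestronglyMeasurable
    · filter_upwards [hf] with ω hω using hω.tendsto_sum_nat
  have hf0 : 0 ≤ᵐ[μ] f := by
    filter_upwards [hf] with ω hω using hω.nonneg fun e => hF0 e ω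
  have hI0 : ∀ e, 0 ≤ ∫ ω, F e ω ∂μ := fun e => integral_nonneg (hF0 e)
  have hlin : ∫⁻ ω, ENNReal.ofReal (f ω) ∂μ = ENNReal.ofReal s := by
    calc ∫⁻ ω, ENNReal.ofReal (f ω) ∂μ = ∫⁻ ω, ∑' e, ENNReal.ofReal (F e ω) ∂μ := by
          refine lintegral_congr_ae ?_
          filter_upwards [hf] with ω hω
          rw [← hω.tsum_eq, ENNReal.ofReal_tsum_of_nonneg (fun e => hF0 e ω) hω.summable]
      _ = ∑' e, ∫⁻ ω, ENNReal.ofReal (F e ω) ∂μ :=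
          lintegral_tsum fun e => (hF e).aestronglyMeasurable.aemeasurable.ennreal_ofReal
      _ = ∑' e, ENNReal.ofReal (∫ ω, F e ω ∂μ) := by
          congr 1
          ext e
          rw [ofReal_integral_eq_lintegral_ofReal (hF e) (ae_of_all _ (hF0 e))]
      _ = ENNReal.ofReal s := by
          rw [← hs.tsum_eq, ENNReal.ofReal_tsum_of_nonneg hI0 hs.summable]
  have hint : Integrable f μ := by
    rw [← lintegral_ofReal_ne_top_iff_integrable hmeas hf0, hlin]
    exact ENNReal.ofReal_ne_top
  refine ⟨hint, ?_⟩
  rw [integral_eq_lintegral_of_nonneg_ae hf0 hmeas, hlin, ENNReal.toReal_ofReal (hs.nonneg hI0)]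

variable {Ω : Type*} [MeasurableSpace Ω] {μ : Measure Ω} [IsProbabilityMeasure μ]
  {K : Type*} [DecidableEq K] {p q : ℝ} {H : K → ℕ → Ω → Bool}

omit [IsProbabilityMeasure μ] [DecidableEq K] in
-- The surviving set takes finitely many values, each on an event given by finitely many keys.
lemma measurable_keep (hmeas : ∀ x j, Measurable (H x j)) (d : ℕ) (S : Finset K)
    (P : Finset K → Prop) : MeasurableSet {ω | P (keep (fun x j => H x j ω) d S)} := by
  classical
  have h1 : ∀ T, MeasurableSet {ω | keep (fun x j => H x j ω) d S = T} := by
    intro T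
    by_cases hT : T ⊆ S
    · have : {ω | keep (fun x j => H x j ω) d S = T} =
          ⋂ x ∈ S, {ω | StartsWithZeros (fun j => H x j ω) d ↔ x ∈ T} := by
        ext ω
        simp only [Set.mem_ofPred_eq, Set.mem_iInter, Finset.ext_iff, keep, Finset.mem_filter]
        refine ⟨fun h x hx => by simpa [hx] using h x, fun h x => ?_⟩
        by_cases hx : x ∈ S
        · simpa [hx] using h x hx
        · simpa [hx] using fun h => hx (hT h)
      rw [this]
      exact Finset.measurableSet_biInter _ fun x _ =>
        (measurableSet_startsWithZeros hmeas x _).iff (MeasurableSet.const _)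
    · have : {ω | keep (fun x j => H x j ω) d S = T} = ∅ := by
        ext ω
        simp only [Set.mem_ofPred_eq, Set.mem_empty_iff_false, iff_false]
        rintro rfl
        exact hT (Finset.filter_subset _ _)
      rw [this]
      exact MeasurableSet.empty
  have h2 : {ω | P (keep (fun x j => H x j ω) d S)} =
      ⋃ T ∈ S.powerset.filter P, {ω | keep (fun x j => H x j ω) d S = T} := by
    ext ω
    simp [keep]
  rw [h2]
  exact Finset.measurableSet_biUnion _ fun T _ => h1 T

/-- The falling factorial is j! times the number of surviving j-subsets; linearity of expectation
leaves one probability per subset, the same for all of them. -/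
lemma integral_descFactorial_mul (hp0 : 0 < p) (hq : q = 1 - p)
    (hmeas : ∀ x j, Measurable (H x j)) (hindep : iIndepFun (fun i : K × ℕ => H i.1 i.2) μ)
    (hlaw : ∀ x j, μ {ω | H x j ω = true} = ENNReal.ofReal p) (S : Finset K) {j b : ℕ}
    (hb : j ≤ b) {e d : ℕ} (hed : e ≤ d) :
    Integrable (fun ω => ((keep (fun x j => H x j ω) d S).card.descFactorial j : ℝ) *
      if b < (keep (fun x j => H x j ω) e S).card then 1 else 0) μ ∧
    ∫ ω, ((keep (fun x j => H x j ω) d S).card.descFactorial j : ℝ) *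
      (if b < (keep (fun x j => H x j ω) e S).card then 1 else 0) ∂μ =
      (S.card.descFactorial j : ℝ) * (q ^ (d * j) * binTail (S.card - j) (b - j) (q ^ e)) := by
  set A : Finset K → Set Ω := fun J => {ω | J ⊆ keep (fun x j => H x j ω) d S ∧
    b < (keep (fun x j => H x j ω) e S).card} with hA
  have hAm : ∀ J, MeasurableSet (A J) := fun J =>
    (measurable_keep hmeas d S (fun T => J ⊆ T)).inter
      (measurable_keep hmeas e S (fun T => b < T.card))
  have hfun : (fun ω => ((keep (fun x j => H x j ω) d S).card.descFactorial j : ℝ) *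
      if b < (keep (fun x j => H x j ω) e S).card then 1 else 0) =
      fun ω => ∑ J ∈ S.powersetCard j, (j ! : ℝ) * (A J).indicator 1 ω := by
    ext ω
    have h1 : S.powersetCard j ∩ (keep (fun x j => H x j ω) d S).powersetCard j =
        (keep (fun x j => H x j ω) d S).powersetCard j :=
      Finset.inter_eq_right.2 (Finset.powersetCard_mono (Finset.filter_subset _ _))
    rw [Nat.descFactorial_eq_factorial_mul_choose, ← Finset.card_powersetCard, ← h1,
      ← Finset.mul_sum, Nat.cast_mul, mul_assoc]
    congr 1
    have h2 : ∀ J ∈ S.powersetCard j, (A J).indicator (1 : Ω → ℝ) ω =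
        if J ∈ (keep (fun x j => H x j ω) d S).powersetCard j then
          (if b < (keep (fun x j => H x j ω) e S).card then 1 else 0) else 0 := by
      intro J hJ
      simp only [hA, Set.indicator_apply, Set.mem_ofPred_eq, Finset.mem_powersetCard,
        (Finset.mem_powersetCard.1 hJ).2, and_true, Pi.one_apply]
      by_cases h3 : J ⊆ keep (fun x j => H x j ω) d S <;> simp [h3]
    rw [Finset.sum_congr rfl h2, Finset.sum_ite_mem, Finset.sum_const, nsmul_eq_mul]
  have hint : ∀ J, Integrable (fun ω => (j ! : ℝ) * (A J).indicator 1 ω) μ := fun J =>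
    ((integrable_const (1 : ℝ)).indicator (hAm J)).const_mul _
  rw [hfun]
  refine ⟨integrable_finsetSum _ fun J _ => hint J, ?_⟩
  rw [integral_finsetSum _ fun J _ => hint J]
  have hval : ∀ J ∈ S.powersetCard j, ∫ ω, (j ! : ℝ) * (A J).indicator 1 ω ∂μ =
      (j ! : ℝ) * (q ^ (d * j) * binTail (S.card - j) (b - j) (q ^ e)) := by
    intro J hJ
    obtain ⟨h1, h2⟩ := Finset.mem_powersetCard.1 hJ
    rw [integral_const_mul, integral_indicator_one (hAm J),
      measureReal_subset_keep hp0 hq hmeas hindep hlaw h1 (h2.le.trans hb) hed, h2]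
  rw [Finset.sum_congr rfl hval, Finset.sum_const, Finset.card_powersetCard, nsmul_eq_mul,
    Nat.descFactorial_eq_factorial_mul_choose, Nat.cast_mul]
  ring

omit [DecidableEq K] in
lemma ae_exists_true (hp0 : 0 < p) (hp1 : p < 1) (hq : q = 1 - p)
    (hmeas : ∀ x j, Measurable (H x j)) (hindep : iIndepFun (fun i : K × ℕ => H i.1 i.2) μ)
    (hlaw : ∀ x j, μ {ω | H x j ω = true} = ENNReal.ofReal p) (S : Finset K) :
    ∀ᵐ ω ∂μ, ∀ x ∈ S, ∃ j, H x j ω = true := by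
  rw [Finset.eventually_all]
  intro x _
  rw [ae_iff]
  have hq0 : 0 ≤ q := by linarith
  have hle : ∀ d : ℕ, μ.real {ω | ¬ ∃ j, H x j ω = true} ≤ q ^ d := by
    intro d
    rw [← measureReal_startsWithZeros hp0 hq hmeas hindep hlaw x d]
    refine measureReal_mono fun ω hω j _ => ?_
    simpa using not_exists.1 hω j
  have h0 : μ.real {ω | ¬ ∃ j, H x j ω = true} = 0 :=
    le_antisymm (ge_of_tendsto' (tendsto_pow_atTop_nhds_zero_of_lt_one hq0 (by linarith)) hle)
      measureReal_nonneg
  exact (measureReal_eq_zero_iff).1 h0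

/-- The exact moments of the estimator when there are more than `b` distinct keys. -/
lemma integral_Z_pow (hp0 : 0 < p) (hp1 : p < 1) (hq : q = 1 - p)
    (hmeas : ∀ x j, Measurable (H x j)) (hindep : iIndepFun (fun i : K × ℕ => H i.1 i.2) μ)
    (hlaw : ∀ x j, μ {ω | H x j ω = true} = ENNReal.ofReal p) (S : List K) {b k n : ℕ}
    (hS : S.toFinset.card = n) (hkb : k ≤ b) (hbn : b < n) :
    Integrable (fun ω => Z q b (fun x j => H x j ω) S ^ k) μ ∧
    ∫ ω, Z q b (fun x j => H x j ω) S ^ k ∂μ =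
      (∑ j ∈ Finset.range (k + 1), (Nat.stirlingSecond k j : ℝ) * ((n.descFactorial j : ℝ) *
        (((1 / q) ^ (k - j) - 1) * depthSum q (k - j) (n - j) (b - j) + 1))) / (n : ℝ) ^ k := by
  have hq0 : 0 < q := by linarith
  have hq1 : q < 1 := by linarith
  set T := S.toFinset with hT
  set N : ℕ → Ω → ℕ := fun d ω => (keep (fun x j => H x j ω) d T).card with hN
  -- `F e` is R^k Q^{kD} on the layer D = e + 1 and 0 elsewhere.
  set F : ℕ → Ω → ℝ := fun e ω => (1 / q) ^ (k * (e + 1)) * (N (e + 1) ω : ℝ) ^ k *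
    ((if b < N e ω then 1 else 0) - if b < N (e + 1) ω then 1 else 0) with hF
  have hNle : ∀ e ω, N (e + 1) ω ≤ N e ω := fun e ω =>
    Finset.card_le_card (keep_subset_keep _ (Nat.le_succ e) _)
  have hF0 : ∀ e ω, 0 ≤ F e ω := by
    intro e ω
    refine mul_nonneg (by positivity) ?_
    have := hNle e ω
    split_ifs with h1 h2 h2
    · norm_num
    · norm_num
    · omega
    · norm_num
  set G : ℕ → ℕ → ℕ → Ω → ℝ := fun j d e ω =>
    ((N d ω).descFactorial j : ℝ) * (if b < N e ω then 1 else 0) with hG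
  have hFG : ∀ e, F e = fun ω => ∑ j ∈ Finset.range (k + 1),
      (1 / q) ^ (k * (e + 1)) * ((Nat.stirlingSecond k j : ℝ) *
        (G j (e + 1) e ω - G j (e + 1) (e + 1) ω)) := by
    intro e
    ext ω
    have := pow_eq_sum_stirlingSecond (N (e + 1) ω) k
    have h2 : (N (e + 1) ω : ℝ) ^ k = ∑ j ∈ Finset.range (k + 1),
        (Nat.stirlingSecond k j : ℝ) * ((N (e + 1) ω).descFactorial j : ℝ) := by
      exact_mod_cast this
    simp only [hF, hG, h2, ← Finset.mul_sum, mul_assoc]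
    congr 1
    rw [Finset.sum_mul]
    exact Finset.sum_congr rfl fun j _ => by ring
  have hGint : ∀ j ∈ Finset.range (k + 1), ∀ e d, e ≤ d → Integrable (G j d e) μ ∧
      ∫ ω, G j d e ω ∂μ =
        (n.descFactorial j : ℝ) * (q ^ (d * j) * binTail (n - j) (b - j) (q ^ e)) := by
    intro j hj e d hed
    have := integral_descFactorial_mul hp0 hq hmeas hindep hlaw T (b := b) (j := j)
      (by have := Finset.mem_range.1 hj; omega) hed
    rwa [hS] at this
  have hterm : ∀ e, ∀ j ∈ Finset.range (k + 1), Integrable (fun ω =>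
      (1 / q) ^ (k * (e + 1)) * ((Nat.stirlingSecond k j : ℝ) *
        (G j (e + 1) e ω - G j (e + 1) (e + 1) ω))) μ := fun e j hj =>
    (((hGint j hj e (e + 1) (Nat.le_succ e)).1.sub
      (hGint j hj (e + 1) (e + 1) le_rfl).1).const_mul _).const_mul _
  have hFint : ∀ e, Integrable (F e) μ := by
    intro e
    rw [hFG]
    exact integrable_finsetSum _ (hterm e)
  have hFval : ∀ e, ∫ ω, F e ω ∂μ = ∑ j ∈ Finset.range (k + 1), (Nat.stirlingSecond k j : ℝ) *
      ((n.descFactorial j : ℝ) * ((1 / q) ^ (k * (e + 1)) * (q ^ ((e + 1) * j) *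
        (binTail (n - j) (b - j) (q ^ e) - binTail (n - j) (b - j) (q ^ (e + 1)))))) := by
    intro e
    rw [hFG, integral_finsetSum _ (hterm e)]
    refine Finset.sum_congr rfl fun j hj => ?_
    obtain ⟨h1, h2⟩ := hGint j hj e (e + 1) (Nat.le_succ e)
    obtain ⟨h3, h4⟩ := hGint j hj (e + 1) (e + 1) le_rfl
    rw [integral_const_mul, integral_const_mul, integral_sub h1 h3, h2, h4]
    ring
  have hsum : HasSum (fun e => ∫ ω, F e ω ∂μ)
      (∑ j ∈ Finset.range (k + 1), (Nat.stirlingSecond k j : ℝ) * ((n.descFactorial j : ℝ) *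
        (((1 / q) ^ (k - j) - 1) * depthSum q (k - j) (n - j) (b - j) + 1))) := by
    simp only [hFval]
    refine hasSum_sum fun j hj => ?_
    exact ((hasSum_binTail_sub hq0 hq1 (by have := Finset.mem_range.1 hj; omega)
      hkb hbn).mul_left _).mul_left _
  have hae : ∀ᵐ ω ∂μ, HasSum (fun e => F e ω)
      (Z q b (fun x j => H x j ω) S ^ k * (n : ℝ) ^ k) := by
    filter_upwards [ae_exists_true hp0 hp1 hq hmeas hindep hlaw T] with ω hω
    have h1 := hasSum_layers b (fun x j => H x j ω) T hω (by omega)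
      (fun d N => (1 / q) ^ (k * d) * (N : ℝ) ^ k)
    rw [Z_eq q b _ S (fun x hx => hω x (List.mem_toFinset.2 hx)), ← hT, hS]
    have hn : (n : ℝ) ≠ 0 := by
      have : n ≠ 0 := by omega
      exact_mod_cast this
    convert! h1 using 1
    rw [div_pow, div_mul_cancel₀ _ (pow_ne_zero _ hn), mul_pow, mul_comm k, pow_mul]
    ring
  obtain ⟨h1, h2⟩ := integrable_and_integral_eq_of_hasSum hFint hF0 hae hsum
  have hn : (n : ℝ) ^ k ≠ 0 := by
    have : n ≠ 0 := by omega
    exact pow_ne_zero _ (by exact_mod_cast this)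
  constructor
  · have := h1.div_const ((n : ℝ) ^ k)
    simpa [mul_div_cancel_right₀ _ hn] using this
  · rw [eq_div_iff hn, ← integral_mul_const, h2]

/-- Without overflow D = 0 and R = n. The quotient is not simplified to 1, so that the empty stream,
where it is 0 / 0 = 0, is covered. -/
lemma Z_ae_eq_of_card_le (hp0 : 0 < p) (hp1 : p < 1) (hq : q = 1 - p)
    (hmeas : ∀ x j, Measurable (H x j)) (hindep : iIndepFun (fun i : K × ℕ => H i.1 i.2) μ)
    (hlaw : ∀ x j, μ {ω | H x j ω = true} = ENNReal.ofReal p) (S : List K) {b : ℕ}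
    (hS : S.toFinset.card ≤ b) :
    (fun ω => Z q b (fun x j => H x j ω) S) =ᵐ[μ]
      fun _ => (S.toFinset.card : ℝ) / S.toFinset.card := by
  filter_upwards [ae_exists_true hp0 hp1 hq hmeas hindep hlaw S.toFinset] with ω hω
  have h0 : depth b (fun x j => H x j ω) S.toFinset = 0 :=
    Nat.le_zero.1 ((card_keep_le_iff b _ _ hω 0).1 (by simpa using hS))
  rw [Z_eq q b _ S (fun x hx => hω x (List.mem_toFinset.2 hx)), h0]
  simp

lemma integrable_Z_pow (hp0 : 0 < p) (hp1 : p < 1) (hq : q = 1 - p)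
    (hmeas : ∀ x j, Measurable (H x j)) (hindep : iIndepFun (fun i : K × ℕ => H i.1 i.2) μ)
    (hlaw : ∀ x j, μ {ω | H x j ω = true} = ENNReal.ofReal p) (S : List K) {b k : ℕ}
    (hkb : k ≤ b) : Integrable (fun ω => Z q b (fun x j => H x j ω) S ^ k) μ := by
  rcases le_or_gt S.toFinset.card b with h | h
  · refine (integrable_const (((S.toFinset.card : ℝ) / S.toFinset.card) ^ k)).congr ?_
    filter_upwards [Z_ae_eq_of_card_le hp0 hp1 hq hmeas hindep hlaw S h] with ω hω
    rw [hω]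
  · exact (integral_Z_pow hp0 hp1 hq hmeas hindep hlaw S rfl hkb h).1

end Moments

/-! ### The Poisson tail -/

section PoissonTail

/-- `P(X > c)` for a Poisson variable `X` with parameter `u`. -/
noncomputable def poissonTail (c : ℕ) (u : ℝ) : ℝ :=
  1 - Real.exp (-u) * ∑ i ∈ Finset.range (c + 1), u ^ i / i !

lemma hasDerivAt_sum_pow_div_factorial (c : ℕ) (u : ℝ) :
    HasDerivAt (fun u : ℝ => ∑ i ∈ Finset.range (c + 1), u ^ i / i !)
      (∑ i ∈ Finset.range c, u ^ i / i !) u := by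
  induction c with
  | zero => simpa using hasDerivAt_const u (1 : ℝ)
  | succ c ih =>
    have h1 : HasDerivAt (fun u : ℝ => u ^ (c + 1) / (c + 1)!) (u ^ c / c !) u := by
      have := (hasDerivAt_pow (c + 1) u).div_const ((c + 1)! : ℝ)
      convert! this using 1
      rw [Nat.factorial_succ]
      have : (c ! : ℝ) ≠ 0 := by positivity
      push_cast
      field_simp
    simp only [Finset.sum_range_succ _ (c + 1)]
    rw [Finset.sum_range_succ _ c]
    exact ih.add h1

/-- The derivative telescopes to a single Poisson weight. This gives monotonicity, the bound near 0,
and later the Mellin transform. -/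
lemma hasDerivAt_poissonTail (c : ℕ) (u : ℝ) :
    HasDerivAt (poissonTail c) (Real.exp (-u) * u ^ c / c !) u := by
  have h1 : HasDerivAt (fun u : ℝ => Real.exp (-u)) (-Real.exp (-u)) u := by
    simpa using (hasDerivAt_neg u).exp
  have h2 := (h1.mul (hasDerivAt_sum_pow_div_factorial c u)).const_sub 1
  convert! h2 using 1
  rw [Finset.sum_range_succ]
  ring

lemma continuous_poissonTail (c : ℕ) : Continuous (poissonTail c) :=
  continuous_iff_continuousAt.2 fun u => (hasDerivAt_poissonTail c u).continuousAt

lemma poissonTail_zero (c : ℕ) : poissonTail c 0 = 0 := by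
  rw [poissonTail, Finset.sum_eq_single 0]
  · simp
  · intro i _ hi; simp [hi]
  · simp

lemma poissonTail_strictMonoOn (c : ℕ) : StrictMonoOn (poissonTail c) (Set.Ici 0) := by
  refine strictMonoOn_of_deriv_pos (convex_Ici 0) (continuous_poissonTail c).continuousOn ?_
  intro u hu
  rw [interior_Ici, Set.mem_Ioi] at hu
  rw [(hasDerivAt_poissonTail c u).deriv]
  positivity

lemma poissonTail_pos (c : ℕ) {u : ℝ} (hu : 0 < u) : 0 < poissonTail c u := by
  rw [← poissonTail_zero c]
  exact poissonTail_strictMonoOn c (Set.mem_Ici.2 le_rfl) (Set.mem_Ici.2 hu.le) hu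

lemma poissonTail_le_one (c : ℕ) {u : ℝ} (hu : 0 ≤ u) : poissonTail c u ≤ 1 := by
  have : 0 ≤ Real.exp (-u) * ∑ i ∈ Finset.range (c + 1), u ^ i / i ! := by positivity
  rw [poissonTail]
  linarith

lemma poissonTail_le_pow (c : ℕ) {u : ℝ} (hu : 0 ≤ u) : poissonTail c u ≤ u ^ (c + 1) := by
  have hd : ∀ u : ℝ, HasDerivAt (fun u => u ^ (c + 1) - poissonTail c u)
      (((c + 1 : ℕ) : ℝ) * u ^ c - Real.exp (-u) * u ^ c / c !) u := fun u =>
    (hasDerivAt_pow (c + 1) u).fun_sub (hasDerivAt_poissonTail c u)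
  have hmono : MonotoneOn (fun u => u ^ (c + 1) - poissonTail c u) (Set.Ici 0) := by
    refine monotoneOn_of_deriv_nonneg (convex_Ici 0)
      (fun u _ => (hd u).continuousAt.continuousWithinAt)
      (fun u _ => (hd u).differentiableAt.differentiableWithinAt) ?_
    intro u hu
    rw [interior_Ici, Set.mem_Ioi] at hu
    rw [(hd u).deriv, sub_nonneg]
    have h1 : Real.exp (-u) ≤ 1 := Real.exp_le_one_iff.2 (by linarith)
    have h2 : (1 : ℝ) ≤ c ! := by exact_mod_cast Nat.one_le_iff_ne_zero.2 (Nat.factorial_ne_zero c)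
    calc Real.exp (-u) * u ^ c / c ! ≤ Real.exp (-u) * u ^ c := div_le_self (by positivity) h2
      _ ≤ 1 * u ^ c := by gcongr
      _ ≤ ((c + 1 : ℕ) : ℝ) * u ^ c := by
        gcongr
        push_cast
        linarith [(Nat.cast_nonneg c : (0 : ℝ) ≤ c)]
  have := hmono (Set.mem_Ici.2 le_rfl) (Set.mem_Ici.2 hu) hu
  simpa [poissonTail_zero] using this

end PoissonTail

/-! ### Mellin transform of the Poisson tail -/

section Mellin

lemma norm_Gamma_le {z : ℂ} (hz : 0 < z.re) : ‖Complex.Gamma z‖ ≤ Real.Gamma z.re := by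
  rw [Complex.Gamma_eq_integral hz, Real.Gamma_eq_integral hz, Complex.GammaIntegral]
  refine (norm_integral_le_integral_norm _).trans_eq ?_
  refine setIntegral_congr_fun measurableSet_Ioi fun x hx => ?_
  simp only [norm_mul, Complex.norm_real, Real.norm_eq_abs, abs_of_pos (Real.exp_pos _)]
  rw [Complex.norm_cpow_eq_rpow_re_of_pos hx]
  simp

/-- The Gamma quotient is the rising factorial of s + 1, that is, c! times a binomial coefficient; a
nonzero imaginary part keeps s away from the poles. -/
lemma Gamma_add_mul_choose (s : ℂ) (hs : s.im ≠ 0) (c : ℕ) :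
    Complex.Gamma (s + c + 1) = s * (Complex.Gamma s * (c ! * Ring.choose (s + c) c)) := by
  have hs0 : s ≠ 0 := by rintro rfl; simp at hs
  have h1 : ∀ i : ℕ, s + 1 ≠ -i := by
    intro i h
    have := congrArg Complex.im h
    simp at this
    exact hs this
  have h2 : (ascPochhammer ℂ c).eval (s + 1) = c ! * Ring.choose (s + c) c := by
    have := Ring.factorial_nsmul_multichoose_eq_ascPochhammer (s + 1) c
    rw [Ring.multichoose_eq, nsmul_eq_mul, Polynomial.ascPochhammer_smeval_eq_eval] at this
    rw [← this]
    congr 2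
    ring
  rw [← h2, ← Complex.Gamma_add_nat_div_Gamma_eq _ h1, ← mul_assoc, ← Complex.Gamma_add_one _ hs0,
    mul_div_cancel₀ _ (Complex.Gamma_ne_zero h1), add_right_comm]

/-- Integration by parts moves the derivative to the tail and leaves a Gamma integrand. The bounds
u^(c+1) at 0 and 1 at infinity give both the strip of convergence and the vanishing boundary terms.
-/
lemma mellin_poissonTail (c : ℕ) {s : ℂ} (hs : s.re < 0) (hs' : -((c : ℝ) + 1) < s.re) :
    mellin (fun u => (poissonTail c u : ℂ)) s = -(Complex.Gamma (s + c + 1) / (s * c !)) := by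
  have hs0 : s ≠ 0 := by rintro rfl; simp at hs
  have hre : 0 < (s + c + 1).re := by simp; linarith
  have hcont : Continuous fun u => (poissonTail c u : ℂ) :=
    Complex.continuous_ofReal.comp (continuous_poissonTail c)
  have hconv : MellinConvergent (fun u => (poissonTail c u : ℂ)) s := by
    refine mellinConvergent_of_isBigO_rpow (a := 0) (b := -((c : ℝ) + 1))
      (hcont.locallyIntegrable.locallyIntegrableOn _) ?_ hs ?_ hs'
    · refine IsBigO.of_bound 1 ?_
      filter_upwards [eventually_gt_atTop 0] with u hu
      rw [Complex.norm_real, Real.norm_eq_abs, abs_of_pos (poissonTail_pos c hu)]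
      simpa using poissonTail_le_one c hu.le
    · refine IsBigO.of_bound 1 ?_
      filter_upwards [self_mem_nhdsWithin] with u hu
      rw [Set.mem_Ioi] at hu
      rw [Complex.norm_real, Real.norm_eq_abs, abs_of_pos (poissonTail_pos c hu), neg_neg, one_mul,
        Real.norm_eq_abs, abs_of_pos (by positivity)]
      have := poissonTail_le_pow c hu.le
      rw [← Real.rpow_natCast] at this
      simpa using this
  have hv : ∀ x ∈ Set.Ioi (0 : ℝ),
      HasDerivAt (fun u : ℝ => (u : ℂ) ^ s / s) ((x : ℂ) ^ (s - 1)) x := by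
    intro x hx
    have h1 : HasDerivAt (fun z : ℂ => z ^ s) (s * (x : ℂ) ^ (s - 1)) (x : ℂ) := by
      simpa using (hasDerivAt_id (x : ℂ)).cpow_const (c := s) (Or.inl (by simpa using hx))
    have h2 := h1.comp_ofReal.div_const s
    rwa [mul_div_cancel_left₀ _ hs0] at h2
  have hu : ∀ x ∈ Set.Ioi (0 : ℝ), HasDerivAt (fun u => (poissonTail c u : ℂ))
      ((Real.exp (-x) * x ^ c / c ! : ℝ) : ℂ) x := fun x _ =>
    (hasDerivAt_poissonTail c x).ofReal_comp
  have hprod : ∀ x ∈ Set.Ioi (0 : ℝ), ((Real.exp (-x) * x ^ c / c ! : ℝ) : ℂ) *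
      ((x : ℂ) ^ s / s) =
      (1 / (s * c !)) * ((Real.exp (-x) : ℂ) * (x : ℂ) ^ (s + c + 1 - 1)) := by
    intro x hx
    have hx0 : (x : ℂ) ≠ 0 := by exact_mod_cast (ne_of_gt hx)
    rw [add_sub_cancel_right, Complex.cpow_add _ _ hx0, Complex.cpow_natCast]
    push_cast
    have : (c ! : ℂ) ≠ 0 := by exact_mod_cast Nat.factorial_ne_zero c
    field_simp
  have hint := Complex.GammaIntegral_convergent hre
  have hnorm : ∀ x ∈ Set.Ioi (0 : ℝ), ‖(x : ℂ) ^ s / s‖ = x ^ s.re / ‖s‖ := by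
    intro x hx
    rw [norm_div, Complex.norm_cpow_eq_rpow_re_of_pos hx]
  have hmain := integral_Ioi_mul_deriv_eq_deriv_mul (a' := (0 : ℂ)) (b' := (0 : ℂ)) hu hv ?_ ?_ ?_ ?_
  · rw [mellin]
    simp only [smul_eq_mul, mul_comm ((_ : ℂ) ^ (s - 1))]
    rw [hmain, setIntegral_congr_fun measurableSet_Ioi hprod, integral_const_mul,
      Complex.Gamma_eq_integral hre, Complex.GammaIntegral]
    ring
  · refine hconv.congr_fun (fun x _ => ?_) measurableSet_Ioi
    simp [mul_comm]
  · exact IntegrableOn.congr_fun (hint.const_mul (1 / (s * c !)))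
      (fun x hx => (hprod x hx).symm) measurableSet_Ioi
  · rw [tendsto_zero_iff_norm_tendsto_zero]
    have h1 : Tendsto (fun x : ℝ => x ^ ((c : ℝ) + 1 + s.re) / ‖s‖) (𝓝[>] 0) (𝓝 0) := by
      have h2 : ContinuousAt (fun x : ℝ => x ^ ((c : ℝ) + 1 + s.re) / ‖s‖) 0 :=
        (Real.continuousAt_rpow_const _ _ (Or.inr (by linarith))).div_const _
      have h3 := h2.tendsto
      rw [Real.zero_rpow (by linarith), zero_div] at h3
      exact h3.mono_left nhdsWithin_le_nhds
    refine squeeze_zero' (Eventually.of_forall fun x => norm_nonneg _) ?_ h1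
    filter_upwards [self_mem_nhdsWithin] with x hx
    rw [Pi.mul_apply, norm_mul, hnorm x hx, Complex.norm_real, Real.norm_eq_abs,
      abs_of_pos (poissonTail_pos c hx), ← mul_div_assoc, Real.rpow_add hx]
    rw [Set.mem_Ioi] at hx
    have := poissonTail_le_pow c hx.le
    rw [← Real.rpow_natCast] at this
    push_cast at this
    gcongr
  · rw [tendsto_zero_iff_norm_tendsto_zero]
    have h1 : Tendsto (fun x : ℝ => x ^ s.re / ‖s‖) atTop (𝓝 0) := by
      have := (tendsto_rpow_neg_atTop (y := -s.re) (by linarith)).div_const ‖s‖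
      simpa using this
    refine squeeze_zero' (Eventually.of_forall fun x => norm_nonneg _) ?_ h1
    filter_upwards [eventually_gt_atTop 0] with x hx
    rw [Pi.mul_apply, norm_mul, hnorm x hx, Complex.norm_real, Real.norm_eq_abs,
      abs_of_pos (poissonTail_pos c hx)]
    exact mul_le_of_le_one_left (by positivity) (poissonTail_le_one c hx.le)

end Mellin

lemma L_pos {q : ℝ} (hq0 : 0 < q) (hq1 : q < 1) : 0 < L q :=
  Real.log_pos (by rw [one_div]; exact (one_lt_inv₀ hq0).2 hq1)

/-! ### The periodized profile and its Fourier series -/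

section Layer

/-- The function `x ↦ u ^ (-r) P(X > c)`, where `u = q ^ x` and `X` is a Poisson variable with
parameter `u`. -/
noncomputable def layer (q : ℝ) (r c : ℕ) (x : ℝ) : ℝ :=
  Real.exp (r * (L q * x)) * poissonTail c (Real.exp (-(L q * x)))

variable {q : ℝ} {r c : ℕ}

lemma layer_pos (q : ℝ) (r c : ℕ) (x : ℝ) : 0 < layer q r c x :=
  mul_pos (Real.exp_pos _) (poissonTail_pos c (Real.exp_pos _))

lemma continuous_layer (q : ℝ) (r c : ℕ) : Continuous (layer q r c) := by
  have := continuous_poissonTail c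
  unfold layer
  fun_prop

/-- For x ≥ 0 the bound u^(c+1) wins, as c + 1 - r ≥ 1; for x ≤ 0 the bound 1 wins, as r ≥ 1. The
number A is arbitrary so that Poisson and binomial tails are treated alike. -/
lemma exp_mul_le_exp_neg_abs (hq0 : 0 < q) (hq1 : q < 1) (hr : 1 ≤ r) (hrc : r ≤ c) {x A : ℝ}
    (h1 : A ≤ 1) (h2 : A ≤ Real.exp (-(L q * x)) ^ (c + 1)) :
    Real.exp (r * (L q * x)) * A ≤ Real.exp (-(L q * |x|)) := by
  have hL := L_pos hq0 hq1
  have hr' : (1 : ℝ) ≤ r := by exact_mod_cast hr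
  have hrc' : (r : ℝ) ≤ c := by exact_mod_cast hrc
  rcases le_total 0 x with hx | hx
  · refine (mul_le_mul_of_nonneg_left h2 (Real.exp_pos _).le).trans ?_
    rw [← Real.exp_nat_mul, ← Real.exp_add, abs_of_nonneg hx]
    refine Real.exp_le_exp.2 ?_
    have : 0 ≤ L q * x := by positivity
    push_cast
    nlinarith
  · refine (mul_le_of_le_one_right (Real.exp_pos _).le h1).trans (Real.exp_le_exp.2 ?_)
    rw [abs_of_nonpos hx]
    have : L q * x ≤ 0 := mul_nonpos_of_nonneg_of_nonpos hL.le hx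
    nlinarith

lemma layer_le_exp_neg_abs (hq0 : 0 < q) (hq1 : q < 1) (hr : 1 ≤ r) (hrc : r ≤ c) (x : ℝ) :
    layer q r c x ≤ Real.exp (-(L q * |x|)) :=
  exp_mul_le_exp_neg_abs hq0 hq1 hr hrc (poissonTail_le_one c (Real.exp_pos _).le)
    (poissonTail_le_pow c (Real.exp_pos _).le)

/-- The Fourier coefficients of the periodization of `layer`. -/
noncomputable def layerCoeff (q : ℝ) (r c : ℕ) (l : ℤ) : ℂ :=
  1 / (L q : ℂ) * mellin (fun u => (poissonTail c u : ℂ)) (-(r : ℂ) + chi q l)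

lemma chi_re (q : ℝ) (l : ℤ) : (chi q l).re = 0 := by
  have : chi q l = ((2 * l * Real.pi / L q : ℝ) : ℂ) * Complex.I := by
    rw [chi]; push_cast; ring
  rw [this, Complex.re_ofReal_mul, Complex.I_re, mul_zero]

lemma chi_im (q : ℝ) (l : ℤ) : (chi q l).im = 2 * l * Real.pi / L q := by
  have : chi q l = ((2 * l * Real.pi / L q : ℝ) : ℂ) * Complex.I := by
    rw [chi]; push_cast; ring
  rw [this, Complex.im_ofReal_mul, Complex.I_im, mul_one]

/-- The substitution u = exp(-Lx) turns the Mellin integral into a Fourier integral. The rescaling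
by L produces the factor 1/L and matches the frequency l with the imaginary part of χ_l. -/
lemma fourier_layer (hq0 : 0 < q) (hq1 : q < 1) (r c : ℕ) (l : ℤ) :
    FourierTransform.fourier (fun x => (layer q r c x : ℂ)) (l : ℝ) = layerCoeff q r c l := by
  have hL := L_pos hq0 hq1
  rw [layerCoeff, mellin_eq_fourier, Real.fourier_real_eq_integral_exp_smul,
    Real.fourier_real_eq_integral_exp_smul]
  have h1 := MeasureTheory.Measure.integral_comp_mul_left (fun u : ℝ =>
    Complex.exp (((-2 * Real.pi * u * ((-(r : ℂ) + chi q l).im / (2 * Real.pi)) : ℝ) : ℂ) *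
      Complex.I) • (Real.exp (-(-(r : ℂ) + chi q l).re * u) •
        (poissonTail c (Real.exp (-u)) : ℂ))) (L q)
  rw [abs_of_pos (inv_pos.2 hL)] at h1
  have h2 : (1 / (L q : ℂ)) = ((L q)⁻¹ : ℝ) := by push_cast; ring
  rw [h2, ← Complex.real_smul, ← h1]
  refine integral_congr_ae (ae_of_all _ fun x => ?_)
  simp only [Complex.add_re, Complex.add_im, Complex.neg_re, Complex.neg_im, chi_re, chi_im,
    Complex.natCast_re, Complex.natCast_im, layer]
  simp only [smul_eq_mul, Complex.real_smul, Complex.ofReal_mul (Real.exp _)]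
  have h3 : -2 * Real.pi * (L q * x) * ((-0 + 2 * l * Real.pi / L q) / (2 * Real.pi)) =
      -2 * Real.pi * x * l := by
    have := Real.pi_pos
    field_simp
    ring
  rw [h3]
  simp

lemma layerCoeff_eq (hq0 : 0 < q) (hq1 : q < 1) (hr : 1 ≤ r) (hrc : r ≤ c) (l : ℤ) :
    layerCoeff q r c l = 1 / (L q : ℂ) * -(Complex.Gamma (-(r : ℂ) + chi q l + c + 1) /
      ((-(r : ℂ) + chi q l) * c !)) := by
  have hr' : (1 : ℝ) ≤ r := by exact_mod_cast hr
  have hrc' : (r : ℝ) ≤ c := by exact_mod_cast hrc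
  have hre : (-(r : ℂ) + chi q l).re = -r := by simp [chi_re]
  rw [layerCoeff, mellin_poissonTail c (by rw [hre]; linarith) (by rw [hre]; linarith)]

lemma layerCoeff_zero (hq0 : 0 < q) (hq1 : q < 1) (hr : 1 ≤ r) (hrc : r ≤ c) :
    layerCoeff q r c 0 = (((c - r)! : ℝ) / (L q * (r * c !)) : ℝ) := by
  obtain ⟨t, rfl⟩ := Nat.exists_eq_add_of_le hrc
  have h1 : -(r : ℂ) + chi q 0 + ((r + t : ℕ) : ℂ) + 1 = (t : ℂ) + 1 := by
    simp [chi]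
  rw [layerCoeff_eq hq0 hq1 hr hrc, h1, Complex.Gamma_nat_eq_factorial, Nat.add_sub_cancel_left]
  simp only [chi, Int.cast_zero, mul_zero, zero_mul, zero_div, add_zero]
  push_cast
  rw [neg_mul, div_neg, neg_neg, div_mul_div_comm, one_mul]

lemma layerCoeff_of_ne_zero (hq0 : 0 < q) (hq1 : q < 1) (hr : 1 ≤ r) (hrc : r ≤ c) {l : ℤ}
    (hl : l ≠ 0) : layerCoeff q r c l = -(1 / (L q : ℂ) * (Complex.Gamma (-(r : ℂ) + chi q l) *
      Ring.choose ((c : ℂ) - r + chi q l) c)) := by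
  have hL := L_pos hq0 hq1
  have him : (-(r : ℂ) + chi q l).im ≠ 0 := by
    have := Real.pi_pos
    have : (l : ℝ) ≠ 0 := by exact_mod_cast hl
    simp only [Complex.add_im, Complex.neg_im, Complex.natCast_im, chi_im, neg_zero, zero_add]
    positivity
  have hs0 : (-(r : ℂ) + chi q l) ≠ 0 := by
    intro h; rw [h] at him; simp at him
  have hc : (c ! : ℂ) ≠ 0 := by exact_mod_cast Nat.factorial_ne_zero c
  rw [layerCoeff_eq hq0 hq1 hr hrc, Gamma_add_mul_choose _ him, mul_div_mul_left _ _ hs0,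
    mul_left_comm, mul_div_cancel_left₀ _ hc, mul_neg,
    show (c : ℂ) - r + chi q l = -(r : ℂ) + chi q l + c by ring]

/-- The denominator s gives one factor 1/|l|. The functional equation Γ(z+1) = zΓ(z), with Γ bounded
on vertical lines by its value on the real axis, gives a second one; this suffices for absolute
convergence. -/
lemma norm_layerCoeff_le (hq0 : 0 < q) (hq1 : q < 1) (hr : 1 ≤ r) (hrc : r ≤ c) {l : ℤ}
    (hl : l ≠ 0) : ‖layerCoeff q r c l‖ ≤ (1 / L q * (Real.Gamma ((c : ℝ) - r + 2) /
      ((2 * Real.pi / L q) ^ 2 * c !))) * (1 / (l : ℝ) ^ 2) := by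
  have hL := L_pos hq0 hq1
  have hpi := Real.pi_pos
  have hrc' : (r : ℝ) ≤ c := by exact_mod_cast hrc
  set s := -(r : ℂ) + chi q l with hs
  have him : s.im = 2 * l * Real.pi / L q := by simp [hs, chi_im]
  have hre : s.re = -r := by simp [hs, chi_re]
  have hl' : (l : ℝ) ≠ 0 := by exact_mod_cast hl
  have him0 : s.im ≠ 0 := by rw [him]; positivity
  have h1 : |s.im| ≤ ‖s‖ := Complex.abs_im_le_norm s
  have h2 : |s.im| ≤ ‖s + c + 1‖ := by
    have := Complex.abs_im_le_norm (s + c + 1)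
    simpa using this
  have hne : s + c + 1 ≠ 0 := by
    intro h; rw [h, norm_zero] at h2
    exact him0 (abs_eq_zero.1 (le_antisymm h2 (abs_nonneg _)))
  have hpos : 0 < |s.im| := abs_pos.2 him0
  have hG : ‖Complex.Gamma (s + c + 1)‖ ≤ Real.Gamma ((c : ℝ) - r + 2) / |s.im| := by
    have h3 := Complex.Gamma_add_one _ hne
    have hre2 : (s + c + 1 + 1).re = (c : ℝ) - r + 2 := by simp [hre]; ring
    have h4 := norm_Gamma_le (z := s + c + 1 + 1) (by rw [hre2]; linarith)
    rw [hre2, h3, norm_mul] at h4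
    rw [le_div_iff₀ hpos]
    calc _ ≤ ‖Complex.Gamma (s + c + 1)‖ * ‖s + c + 1‖ := by gcongr
      _ ≤ _ := by rw [mul_comm]; exact h4
  have hGp : 0 ≤ Real.Gamma ((c : ℝ) - r + 2) := (Real.Gamma_pos_of_pos (by linarith)).le
  rw [layerCoeff_eq hq0 hq1 hr hrc, norm_mul, norm_neg, norm_div, norm_div, norm_mul, norm_one,
    Complex.norm_real, Real.norm_eq_abs, abs_of_pos hL, Complex.norm_natCast, mul_assoc]
  refine mul_le_mul_of_nonneg_left ?_ (by positivity)
  calc ‖Complex.Gamma (s + c + 1)‖ / (‖s‖ * c !)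
      ≤ (Real.Gamma ((c : ℝ) - r + 2) / |s.im|) / (|s.im| * c !) := by gcongr
    _ = Real.Gamma ((c : ℝ) - r + 2) / (|s.im| ^ 2 * c !) := by
      rw [div_div]; congr 1; ring
    _ = _ := by
      rw [sq_abs, him]
      field_simp

lemma summable_layerCoeff (hq0 : 0 < q) (hq1 : q < 1) (hr : 1 ≤ r) (hrc : r ≤ c) :
    Summable (layerCoeff q r c) := by
  have h1 : Summable fun l : ℤ => (1 / L q * (Real.Gamma ((c : ℝ) - r + 2) /
      ((2 * Real.pi / L q) ^ 2 * c !))) * (1 / (l : ℝ) ^ 2) :=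
    (Real.summable_one_div_int_pow.2 one_lt_two).mul_left _
  refine Summable.of_norm_bounded_eventually h1 ?_
  filter_upwards [(Set.finite_singleton (0 : ℤ)).compl_mem_cofinite] with l hl
  exact norm_layerCoeff_le hq0 hq1 hr hrc (by simpa using hl)

/-- The sum of `layer` over the translates of a lattice of mesh `1`. -/
noncomputable def periodSum (q : ℝ) (r c : ℕ) (x : ℝ) : ℝ := ∑' d : ℤ, layer q r c (d - x)

lemma layer_isBigO (hq0 : 0 < q) (hq1 : q < 1) (hr : 1 ≤ r) (hrc : r ≤ c) :
    (fun x => (layer q r c x : ℂ)) =O[cocompact ℝ] fun x : ℝ => |x| ^ (-(2 : ℝ)) := by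
  have hL := L_pos hq0 hq1
  refine IsBigO.of_bound (2 / L q ^ 2) ?_
  have h0 : ∀ᶠ x : ℝ in cocompact ℝ, x ≠ 0 := by
    simpa using (isCompact_singleton (x := (0 : ℝ))).compl_mem_cocompact
  filter_upwards [h0] with x hx
  have hx' : 0 < |x| := abs_pos.2 hx
  rw [Complex.norm_real, Real.norm_eq_abs, abs_of_pos (layer_pos q r c x), Real.norm_eq_abs,
    abs_of_pos (by positivity), Real.rpow_neg hx'.le]
  refine (layer_le_exp_neg_abs hq0 hq1 hr hrc x).trans ?_
  have h2 := Real.pow_div_factorial_le_exp (L q * |x|) (by positivity) 2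
  rw [Real.exp_neg]
  have h3 : (Real.exp (L q * |x|))⁻¹ ≤ ((L q * |x|) ^ 2 / 2 !)⁻¹ := by gcongr
  refine h3.trans_eq ?_
  have : |x| ^ (2 : ℝ) = |x| ^ 2 := by exact_mod_cast Real.rpow_natCast |x| 2
  rw [this, Nat.factorial_two]
  push_cast
  field_simp

lemma summable_layer (hq0 : 0 < q) (hq1 : q < 1) (hr : 1 ≤ r) (hrc : r ≤ c) (x : ℝ) :
    Summable fun d : ℤ => layer q r c (d - x) := by
  have h1 := (isBigO_norm_restrict_cocompact ⟨_, Complex.continuous_ofReal.comp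
    (continuous_layer q r c)⟩ (zero_lt_two) (layer_isBigO hq0 hq1 hr hrc)
    ⟨{-x}, isCompact_singleton⟩).comp_tendsto Int.tendsto_coe_cofinite
  have h2 := summable_of_isBigO (Real.summable_abs_int_rpow one_lt_two) h1
  refine Summable.of_norm_bounded h2 fun d => ?_
  have h3 := ContinuousMap.norm_coe_le_norm ((ContinuousMap.comp (⟨_, Complex.continuous_ofReal.comp
    (continuous_layer q r c)⟩ : C(ℝ, ℂ)) (ContinuousMap.addRight (d : ℝ))).restrict {-x})
    ⟨-x, rfl⟩
  refine le_trans (le_of_eq ?_) h3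
  simp [sub_eq_neg_add]

/-- Poisson summation at the point -x, which accounts for the negative sign in the exponentials. -/
lemma hasSum_layerCoeff (hq0 : 0 < q) (hq1 : q < 1) (hr : 1 ≤ r) (hrc : r ≤ c) (x : ℝ) :
    HasSum (fun l : ℤ => layerCoeff q r c l * Complex.exp (-(2 * l * Real.pi * Complex.I * x)))
      (periodSum q r c x : ℂ) := by
  have hs : Summable fun l : ℤ => FourierTransform.fourier
      (fun x => (layer q r c x : ℂ)) (l : ℝ) := by
    simp only [fourier_layer hq0 hq1]
    exact summable_layerCoeff hq0 hq1 hr hrc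
  have h1 := Real.tsum_eq_tsum_fourier_of_rpow_decay_of_summable
    (Complex.continuous_ofReal.comp (continuous_layer q r c)) one_lt_two
    (layer_isBigO hq0 hq1 hr hrc) hs (-x)
  have h2 : ∀ l : ℤ, fourier l ((-x : ℝ) : UnitAddCircle) =
      Complex.exp (-(2 * l * Real.pi * Complex.I * x)) := by
    intro l
    rw [fourier_coe_apply]
    congr 1
    push_cast
    ring
  have h3 : (periodSum q r c x : ℂ) = ∑' l : ℤ, layerCoeff q r c l *
      Complex.exp (-(2 * l * Real.pi * Complex.I * x)) := by
    rw [periodSum, Complex.ofReal_tsum]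
    simp only [Function.comp_def] at h1
    simp only [fourier_layer hq0 hq1, h2] at h1
    rw [← h1]
    simp only [sub_eq_neg_add]
  rw [h3]
  refine Summable.hasSum (Summable.of_norm ?_)
  have h4 := (summable_layerCoeff hq0 hq1 hr hrc).norm
  convert! h4 using 2 with l
  rw [norm_mul, ← h2 l]
  have h5 : ‖fourier l ((-x : ℝ) : UnitAddCircle)‖ = 1 := by
    rw [fourier_apply]; exact Circle.norm_coe _
  rw [h5, mul_one]

end Layer

/-! ### Poisson approximation with a bounded, possibly oscillating parameter -/

section PoissonLimit

lemma abs_exp_neg_sub_exp_neg_le {a b : ℝ} (ha : 0 ≤ a) (hb : 0 ≤ b) :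
    |Real.exp (-a) - Real.exp (-b)| ≤ |a - b| := by
  have key : ∀ a b : ℝ, 0 ≤ a → a ≤ b → |Real.exp (-a) - Real.exp (-b)| ≤ |a - b| := by
    intro a b ha hab
    have h1 : Real.exp (-b) ≤ Real.exp (-a) := Real.exp_le_exp.2 (by linarith)
    have h2 : Real.exp (-a) ≤ 1 := Real.exp_le_one_iff.2 (by linarith)
    have h3 : -(b - a) + 1 ≤ Real.exp (-(b - a)) := Real.add_one_le_exp _
    have h4 : Real.exp (-b) = Real.exp (-a) * Real.exp (-(b - a)) := by
      rw [← Real.exp_add]; congr 1; ring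
    rw [abs_of_nonneg (by linarith), abs_of_nonpos (by linarith), h4]
    nlinarith [Real.exp_pos (-a)]
  rcases le_total a b with h | h
  · exact key a b ha h
  · rw [abs_sub_comm, abs_sub_comm a]; exact key b a hb h

lemma abs_one_sub_pow_sub_exp_le {y : ℝ} (h0 : 0 ≤ y) (h1 : y ≤ 1) (N : ℕ) :
    |(1 - y) ^ N - Real.exp (-(N * y))| ≤ N * y ^ 2 := by
  have h2 : Real.exp (-(N * y)) = Real.exp (-y) ^ N := by
    rw [← Real.exp_nat_mul]; congr 1; ring
  have h3 : |(1 - y) - Real.exp (-y)| ≤ y ^ 2 := by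
    have := Real.abs_exp_sub_one_sub_id_le (x := -y) (by rw [abs_neg, abs_of_nonneg h0]; exact h1)
    rw [neg_sq] at this
    rw [abs_sub_comm]
    convert! this using 2
    ring
  have h4 : Real.exp (-y) ≤ 1 := Real.exp_le_one_iff.2 (by linarith)
  rw [h2]
  refine (abs_pow_sub_pow_le _ _ _).trans ?_
  have h5 : max |1 - y| |Real.exp (-y)| ^ (N - 1) ≤ 1 := by
    refine pow_le_one₀ (le_max_of_le_left (abs_nonneg _)) (max_le ?_ ?_)
    · rw [abs_of_nonneg (by linarith)]; linarith
    · rwa [abs_of_pos (Real.exp_pos _)]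
  calc _ ≤ y ^ 2 * N * 1 := by gcongr
    _ = _ := by ring

lemma tendsto_const_div_nat (M : ℝ) : Tendsto (fun n : ℕ => M / n) atTop (𝓝 0) :=
  tendsto_const_nhds.div_atTop tendsto_natCast_atTop_atTop

/-- Replacing 1 - y by exp(-y) costs at most M²/n; the exponent n - s in place of n costs at most
Ms/n. -/
lemma tendsto_one_sub_pow_sub_exp {u : ℕ → ℝ} {M : ℝ} (h0 : ∀ n, 0 ≤ u n) (hM : ∀ n, u n ≤ M)
    (s : ℕ) :
    Tendsto (fun n : ℕ => (1 - u n / n) ^ (n - s) - Real.exp (-u n)) atTop (𝓝 0) := by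
  have hM0 : 0 ≤ M := (h0 0).trans (hM 0)
  have hlim : Tendsto (fun n : ℕ => (M ^ 2 + M * s) / (n : ℝ)) atTop (𝓝 0) :=
    tendsto_const_div_nat _
  refine squeeze_zero_norm' ?_ hlim
  filter_upwards [eventually_ge_atTop (s + 1), eventually_ge_atTop ⌈M⌉₊] with n hn hn'
  have hn0 : (0 : ℝ) < n := by
    have : 0 < n := by omega
    exact_mod_cast this
  have hMn : M ≤ n := (Nat.le_ceil M).trans (by exact_mod_cast hn')
  have hns : ((n - s : ℕ) : ℝ) = n - s := by
    rw [Nat.cast_sub (by omega)]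
  have hu := h0 n
  have hy0 : 0 ≤ u n / n := by positivity
  have hy1 : u n / n ≤ 1 := (div_le_one hn0).2 ((hM n).trans hMn)
  have h1 := abs_one_sub_pow_sub_exp_le hy0 hy1 (n - s)
  have h2 := abs_exp_neg_sub_exp_neg_le (a := ((n - s : ℕ) : ℝ) * (u n / n)) (b := u n)
    (by positivity) (h0 n)
  have h3 : ((n - s : ℕ) : ℝ) * (u n / n) ^ 2 ≤ M ^ 2 / n := by
    calc ((n - s : ℕ) : ℝ) * (u n / n) ^ 2 ≤ n * (M / n) ^ 2 := by
          have : ((n - s : ℕ) : ℝ) ≤ n := by exact_mod_cast Nat.sub_le n s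
          have := hM n
          gcongr
      _ = M ^ 2 / n := by field_simp
  have h4 : |((n - s : ℕ) : ℝ) * (u n / n) - u n| ≤ M * s / n := by
    have : ((n - s : ℕ) : ℝ) * (u n / n) - u n = -(u n * s / n) := by
      rw [hns]; field_simp; ring
    rw [this, abs_neg, abs_of_nonneg (by positivity)]
    have := hM n
    gcongr
  rw [Real.norm_eq_abs, add_div]
  calc |(1 - u n / n) ^ (n - s) - Real.exp (-u n)|
      ≤ |(1 - u n / n) ^ (n - s) - Real.exp (-(((n - s : ℕ) : ℝ) * (u n / n)))| +
        |Real.exp (-(((n - s : ℕ) : ℝ) * (u n / n))) - Real.exp (-u n)| := abs_sub_le _ _ _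
    _ ≤ _ := add_le_add (h1.trans h3) (h2.trans h4)

lemma tendsto_descFactorial_div_pow (j : ℕ) :
    Tendsto (fun n : ℕ => (n.descFactorial j : ℝ) / (n : ℝ) ^ j) atTop (𝓝 1) := by
  refine (isEquivalent_iff_tendsto_one ?_).1 (isEquivalent_descFactorial j)
  filter_upwards [eventually_gt_atTop 0] with n hn
  have : (n : ℝ) ≠ 0 := by exact_mod_cast hn.ne'
  positivity

lemma tendsto_choose_sub_div_pow (j i : ℕ) :
    Tendsto (fun n : ℕ => ((n - j).choose i : ℝ) / (n : ℝ) ^ i) atTop (𝓝 (1 / i !)) := by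
  have h1 : Tendsto (fun n : ℕ => ((n - j).descFactorial i : ℝ) / ((n - j : ℕ) : ℝ) ^ i) atTop
      (𝓝 1) := (tendsto_descFactorial_div_pow i).comp (tendsto_sub_atTop_nat j)
  have h2 : Tendsto (fun n : ℕ => ((n - j : ℕ) : ℝ) / n) atTop (𝓝 1) := by
    have h3 : Tendsto (fun n : ℕ => 1 - (j : ℝ) / n) atTop (𝓝 1) := by
      simpa using (tendsto_const_div_nat (j : ℝ)).const_sub 1
    refine h3.congr' ?_
    filter_upwards [eventually_gt_atTop j] with n hn
    have : (n : ℝ) ≠ 0 := by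
      have : n ≠ 0 := by omega
      exact_mod_cast this
    rw [Nat.cast_sub hn.le]
    field_simp
  have h4 := (h1.mul (h2.pow i)).div_const (i ! : ℝ)
  rw [one_pow, mul_one] at h4
  refine h4.congr' ?_
  filter_upwards [eventually_gt_atTop j] with n hn
  have hnj : ((n - j : ℕ) : ℝ) ≠ 0 := by
    have : n - j ≠ 0 := by omega
    exact_mod_cast this
  have hf : (i ! : ℝ) ≠ 0 := by positivity
  rw [Nat.descFactorial_eq_factorial_mul_choose, Nat.cast_mul, div_pow]
  field_simp

/-- Needed because the second factors oscillate with log_Q n: only their difference converges. -/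
lemma tendsto_mul_sub_mul {a : ℕ → ℝ} {l C : ℝ} {g g' : ℕ → ℝ} (ha : Tendsto a atTop (𝓝 l))
    (hg : Tendsto (fun n => g n - g' n) atTop (𝓝 0)) (hC : ∀ n, |g' n| ≤ C) :
    Tendsto (fun n => a n * g n - l * g' n) atTop (𝓝 0) := by
  have h1 : Tendsto (fun n => a n * (g n - g' n)) atTop (𝓝 0) := by simpa using ha.mul hg
  have h2 : Tendsto (fun n => (a n - l) * g' n) atTop (𝓝 0) := by
    refine bdd_le_mul_tendsto_zero' C (Eventually.of_forall hC) ?_ |>.congr fun n => mul_comm _ _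
    simpa using ha.sub_const l
  have h3 := h1.add h2
  rw [add_zero] at h3
  refine h3.congr fun n => ?_
  ring

lemma tendsto_binTail_sub_poissonTail {u : ℕ → ℝ} {M : ℝ} (h0 : ∀ n, 0 ≤ u n)
    (hM : ∀ n, u n ≤ M) (j c : ℕ) :
    Tendsto (fun n : ℕ => binTail (n - j) c (u n / n) - poissonTail c (u n)) atTop (𝓝 0) := by
  have hterm : ∀ i ∈ Finset.range (c + 1), Tendsto (fun n : ℕ =>
      u n ^ i * (((n - j).choose i : ℝ) / (n : ℝ) ^ i * (1 - u n / n) ^ (n - (j + i)) -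
        1 / i ! * Real.exp (-u n))) atTop (𝓝 0) := by
    intro i _
    refine bdd_le_mul_tendsto_zero' (M ^ i) (Eventually.of_forall fun n => ?_) ?_
    · rw [abs_of_nonneg (pow_nonneg (h0 n) _)]
      exact pow_le_pow_left₀ (h0 n) (hM n) i
    · refine tendsto_mul_sub_mul (C := 1) (tendsto_choose_sub_div_pow j i)
        (tendsto_one_sub_pow_sub_exp h0 hM (j + i)) (fun n => ?_)
      rw [abs_of_pos (Real.exp_pos _)]
      exact Real.exp_le_one_iff.2 (by linarith [h0 n])
  have hsum := (tendsto_finsetSum _ hterm).neg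
  simp only [Finset.sum_const_zero, neg_zero] at hsum
  refine hsum.congr' ?_
  filter_upwards [eventually_ge_atTop (j + c), eventually_gt_atTop 0] with n hn hn0
  have hn' : (n : ℝ) ≠ 0 := by exact_mod_cast hn0.ne'
  rw [binTail_eq_one_sub _ _ (by omega), poissonTail, Finset.mul_sum, sub_sub_sub_cancel_left,
    ← Finset.sum_sub_distrib, ← Finset.sum_neg_distrib]
  refine Finset.sum_congr rfl fun i _ => ?_
  rw [div_pow, show n - j - i = n - (j + i) by omega]
  have hf : (i ! : ℝ) ≠ 0 := by positivity
  field_simp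
  ring

end PoissonLimit

/-! ### From the binomial series to the periodic function -/

section Depoissonization

variable {q : ℝ} {r c : ℕ}

lemma summable_exp_neg_abs {a : ℝ} (ha : 0 < a) :
    Summable fun e : ℤ => Real.exp (-(a * |(e : ℝ)|)) := by
  have h : Summable fun n : ℕ => Real.exp (-(a * |((n : ℤ) : ℝ)|)) := by
    have := Real.summable_exp_nat_mul_iff.2 (neg_lt_zero.2 ha)
    refine this.congr fun n => ?_
    congr 1
    rw [Int.cast_natCast, abs_of_nonneg (Nat.cast_nonneg n)]
    ring
  refine Summable.of_nat_of_neg h ?_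
  simpa using h

lemma exp_neg_L_mul_sub_logb (hq0 : 0 < q) (hq1 : q < 1) {n : ℕ} (hn : 0 < n) (d : ℕ) :
    Real.exp (-(L q * ((d : ℝ) - Real.logb (1 / q) n))) = n * q ^ d := by
  have hL := (L_pos hq0 hq1).ne'
  have hn' : (0 : ℝ) < n := by exact_mod_cast hn
  have h1 : L q * Real.logb (1 / q) n = Real.log n := by
    rw [Real.logb, ← L]; field_simp
  have h2 : -(L q * ((d : ℝ) - Real.logb (1 / q) n)) = Real.log n + d * Real.log q := by
    rw [mul_sub, h1, L, Real.log_div one_ne_zero hq0.ne', Real.log_one]; ring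
  rw [h2, Real.exp_add, Real.exp_log hn', Real.exp_nat_mul, Real.exp_log hq0]

/-- The summand of `depthSum`, normalized, as a function of an integer depth. -/
noncomputable def binLayer (q : ℝ) (r c j n : ℕ) (d : ℤ) : ℝ :=
  if 0 ≤ d then Real.exp (r * (L q * (d - Real.logb (1 / q) n))) *
    binTail (n - j) c (q ^ d.toNat) else 0

lemma binLayer_nonneg (hq0 : 0 < q) (hq1 : q < 1) (j n : ℕ) (d : ℤ) :
    0 ≤ binLayer q r c j n d := by
  rw [binLayer]
  split_ifs
  · exact mul_nonneg (Real.exp_pos _).le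
      (binTail_nonneg _ _ (by positivity) (pow_le_one₀ hq0.le hq1.le))
  · exact le_rfl

lemma binLayer_le (hq0 : 0 < q) (hq1 : q < 1) (hr : 1 ≤ r) (hrc : r ≤ c) (j : ℕ) {n : ℕ}
    (hn : 0 < n) (d : ℤ) :
    binLayer q r c j n d ≤ Real.exp (-(L q * |(d : ℝ) - Real.logb (1 / q) n|)) := by
  rw [binLayer]
  split_ifs with hd
  · have hq0' : 0 ≤ q ^ d.toNat := by positivity
    have hq1' : q ^ d.toNat ≤ 1 := pow_le_one₀ hq0.le hq1.le
    refine exp_mul_le_exp_neg_abs hq0 hq1 hr hrc (binTail_le_one _ _ hq0' hq1') ?_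
    have hdn : ((d.toNat : ℕ) : ℝ) = d := by
      have := Int.toNat_of_nonneg hd
      exact_mod_cast this
    have := exp_neg_L_mul_sub_logb hq0 hq1 hn d.toNat
    rw [hdn] at this
    rw [this]
    refine (binTail_le_pow _ _ hq0' hq1').trans ?_
    have : ((n - j : ℕ) : ℝ) ≤ n := by exact_mod_cast Nat.sub_le n j
    gcongr
  · exact (Real.exp_pos _).le

lemma depthSum_div_pow_eq (hq0 : 0 < q) (hq1 : q < 1) (j : ℕ) {n : ℕ} (hn : 0 < n) :
    depthSum q r (n - j) c / (n : ℝ) ^ r = ∑' d : ℤ, binLayer q r c j n d := by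
  have hsupp : Function.support (binLayer q r c j n) ⊆ Set.range ((↑) : ℕ → ℤ) := by
    intro d hd
    by_contra h
    refine hd (if_neg fun h0 => h ⟨d.toNat, Int.toNat_of_nonneg h0⟩)
  rw [← Function.Injective.tsum_eq Nat.cast_injective hsupp, depthSum, ← tsum_div_const]
  refine tsum_congr fun d => ?_
  have h1 := exp_neg_L_mul_sub_logb hq0 hq1 hn d
  have h2 : Real.exp (r * (L q * ((d : ℝ) - Real.logb (1 / q) n))) =
      ((n * q ^ d) ^ r)⁻¹ := by
    rw [← h1, ← Real.exp_nat_mul, ← Real.exp_neg]; congr 1; ring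
  rw [binLayer, if_pos (Int.natCast_nonneg d), Int.toNat_natCast, Int.cast_natCast, h2, mul_pow,
    ← pow_mul, one_div, inv_pow, mul_comm d r, mul_inv]
  ring

/-- Both sums are recentred at the integer part of log_Q n. For a fixed offset e the parameter n q^d
stays bounded, so the Poisson approximation applies; the exponential bound common to both profiles
allows dominated convergence over ℤ. -/
lemma tendsto_depthSum_sub_periodSum (hq0 : 0 < q) (hq1 : q < 1) (hr : 1 ≤ r) (hrc : r ≤ c)
    (j : ℕ) :
    Tendsto (fun n : ℕ => depthSum q r (n - j) c / (n : ℝ) ^ r -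
      periodSum q r c (Real.logb (1 / q) n)) atTop (𝓝 0) := by
  have hL := L_pos hq0 hq1
  set x : ℕ → ℝ := fun n => Real.logb (1 / q) n with hx
  set s : ℕ → ℤ := fun n => ⌊x n⌋ with hs
  have hsx : ∀ (e : ℤ) n, |((e + s n : ℤ) : ℝ) - x n| ≥ |(e : ℝ)| - 1 := by
    intro e n
    have h1 := Int.floor_le (x n)
    have h2 := (Int.lt_floor_add_one (x n)).le
    have h3 : |x n - s n| ≤ 1 := abs_le.2 ⟨by simp only [hs]; linarith, by
      simp only [hs]; linarith⟩
    have h4 : (e : ℝ) = (((e + s n : ℤ) : ℝ) - x n) + (x n - s n) := by push_cast; ring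
    have h5 := abs_add_le (((e + s n : ℤ) : ℝ) - x n) (x n - s n)
    rw [← h4] at h5
    linarith
  -- Recentring by an integer moves the argument by at most 1, hence the factor exp(L).
  set bound : ℤ → ℝ := fun e => Real.exp (L q) * Real.exp (-(L q * |(e : ℝ)|)) with hbound
  have hbs : Summable bound := (summable_exp_neg_abs hL).mul_left _
  have hexp : ∀ (e : ℤ) n, Real.exp (-(L q * |((e + s n : ℤ) : ℝ) - x n|)) ≤ bound e := by
    intro e n
    simp only [hbound]
    rw [← Real.exp_add]
    refine Real.exp_le_exp.2 ?_
    have := mul_le_mul_of_nonneg_left (hsx e n) hL.le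
    linarith
  have hB : ∀ n, 0 < n → ∀ e, binLayer q r c j n (e + s n) ≤ bound e := fun n hn e =>
    (binLayer_le hq0 hq1 hr hrc j hn _).trans (hexp e n)
  have hP : ∀ n e, layer q r c (((e + s n : ℤ) : ℝ) - x n) ≤ bound e := fun n e =>
    (layer_le_exp_neg_abs hq0 hq1 hr hrc _).trans (hexp e n)
  set T : ℕ → ℤ → ℝ := fun n e =>
    binLayer q r c j n (e + s n) - layer q r c (((e + s n : ℤ) : ℝ) - x n) with hT
  have hTb : ∀ᶠ n in atTop, ∀ e, ‖T n e‖ ≤ bound e := by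
    filter_upwards [eventually_gt_atTop 0] with n hn e
    have h1 := hB n hn e
    have h2 := hP n e
    have h3 := binLayer_nonneg (r := r) (c := c) hq0 hq1 j n (e + s n)
    have h4 := (layer_pos q r c (((e + s n : ℤ) : ℝ) - x n)).le
    rw [Real.norm_eq_abs, abs_le]
    constructor <;> simp only [hT] <;> linarith
  have hsinf : Tendsto s atTop atTop :=
    tendsto_floor_atTop.comp ((Real.tendsto_logb_atTop
      (by rw [one_div]; exact (one_lt_inv₀ hq0).2 hq1)).comp tendsto_natCast_atTop_atTop)
  have hT0 : ∀ e, Tendsto (fun n => T n e) atTop (𝓝 0) := by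
    intro e
    set y : ℕ → ℝ := fun n => ((e + s n : ℤ) : ℝ) - x n with hy
    have hy1 : ∀ n, y n ≤ e := fun n => by
      have := Int.floor_le (x n)
      simp only [hy, hs]; push_cast; linarith
    have hy2 : ∀ n, (e : ℝ) - 1 ≤ y n := fun n => by
      have := (Int.lt_floor_add_one (x n)).le
      simp only [hy, hs]; push_cast; linarith
    have h1 := tendsto_binTail_sub_poissonTail (u := fun n => Real.exp (-(L q * y n)))
      (M := Real.exp (-(L q * (e - 1)))) (fun n => (Real.exp_pos _).le)
      (fun n => Real.exp_le_exp.2 (neg_le_neg (mul_le_mul_of_nonneg_left (hy2 n) hL.le))) j c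
    have h2 : Tendsto (fun n => Real.exp (r * (L q * y n)) *
        (binTail (n - j) c (Real.exp (-(L q * y n)) / n) -
          poissonTail c (Real.exp (-(L q * y n))))) atTop (𝓝 0) := by
      refine bdd_le_mul_tendsto_zero' (Real.exp (r * (L q * e))) (Eventually.of_forall fun n => ?_) h1
      rw [abs_of_pos (Real.exp_pos _)]
      have := hy1 n
      gcongr
    refine h2.congr' ?_
    -- For fixed e the actual depth is eventually nonnegative, so the cut-off in `binLayer`
    -- disappears.
    filter_upwards [hsinf.eventually_ge_atTop (-e), eventually_gt_atTop 0] with n hn hn0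
    have hpos : 0 ≤ e + s n := by linarith
    have hdn : (((e + s n).toNat : ℕ) : ℝ) = ((e + s n : ℤ) : ℝ) := by
      have := Int.toNat_of_nonneg hpos
      exact_mod_cast this
    have h3 := exp_neg_L_mul_sub_logb hq0 hq1 hn0 (e + s n).toNat
    rw [hdn] at h3
    have hn' : (n : ℝ) ≠ 0 := by exact_mod_cast hn0.ne'
    have h4 : Real.exp (-(L q * y n)) / n = q ^ (e + s n).toNat := by
      simp only [hy, hx]
      rw [h3, mul_div_cancel_left₀ _ hn']
    simp only [hT, binLayer, if_pos hpos, layer]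
    rw [h4, mul_sub]
  have hmain := tendsto_tsum_of_dominated_convergence hbs hT0 hTb
  rw [tsum_zero] at hmain
  refine hmain.congr' ?_
  filter_upwards [eventually_gt_atTop 0] with n hn
  rw [depthSum_div_pow_eq hq0 hq1 j hn, periodSum,
    ← (Equiv.addRight (s n)).tsum_eq (binLayer q r c j n),
    ← (Equiv.addRight (s n)).tsum_eq (fun d : ℤ => layer q r c (d - Real.logb (1 / q) n)),
    ← Summable.tsum_sub]
  · rfl
  · exact Summable.of_nonneg_of_le (fun e => binLayer_nonneg hq0 hq1 j n _) (hB n hn) hbs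
  · exact Summable.of_nonneg_of_le (fun e => (layer_pos q r c _).le) (hP n) hbs

end Depoissonization

/-! ### Limit of the moments and identification of m and w -/

section Periodic

variable {q : ℝ}

lemma periodSum_nonneg (q : ℝ) (r c : ℕ) (x : ℝ) : 0 ≤ periodSum q r c x :=
  tsum_nonneg fun _ => (layer_pos q r c _).le

lemma norm_exp_neg_two_mul (l : ℤ) (x : ℝ) :
    ‖Complex.exp (-(2 * l * Real.pi * Complex.I * x))‖ = 1 := by
  have : -(2 * (l : ℂ) * Real.pi * Complex.I * x) = ((-(2 * l * Real.pi * x) : ℝ) : ℂ) * Complex.I := by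
    push_cast; ring
  rw [this, Complex.norm_exp_ofReal_mul_I]

lemma exp_neg_two_mul_intCast (l : ℤ) : Complex.exp (-(2 * l * Real.pi * Complex.I)) = 1 := by
  rw [Complex.exp_eq_one_iff]
  exact ⟨-l, by push_cast; ring⟩

lemma periodSum_le (hq0 : 0 < q) (hq1 : q < 1) {r c : ℕ} (hr : 1 ≤ r) (hrc : r ≤ c) (x : ℝ) :
    |periodSum q r c x| ≤ ∑' l, ‖layerCoeff q r c l‖ := by
  have h := hasSum_layerCoeff hq0 hq1 hr hrc x
  have h1 : |periodSum q r c x| = ‖(periodSum q r c x : ℂ)‖ := by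
    rw [Complex.norm_real, Real.norm_eq_abs]
  rw [h1, ← h.tsum_eq]
  refine (norm_tsum_le_tsum_norm h.summable.norm).trans_eq ?_
  simp only [norm_mul, norm_exp_neg_two_mul, mul_one]

/-- All terms are positive, and the one with d = ⌊x⌋ has its argument in [-1, 0], where the
continuous profile has a positive minimum. -/
lemma exists_pos_le_periodSum (hq0 : 0 < q) (hq1 : q < 1) {r c : ℕ} (hr : 1 ≤ r) (hrc : r ≤ c) :
    ∃ δ > 0, ∀ x, δ ≤ periodSum q r c x := by
  obtain ⟨y, _, hy⟩ := isCompact_Icc.exists_isMinOn (Set.nonempty_Icc.2 (by norm_num : (-1 : ℝ) ≤ 0))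
    (continuous_layer q r c).continuousOn
  refine ⟨layer q r c y, layer_pos q r c y, fun x => ?_⟩
  have h1 := Int.floor_le x
  have h2 := Int.lt_floor_add_one x
  have h3 : layer q r c y ≤ layer q r c (⌊x⌋ - x) := hy ⟨by linarith, by linarith⟩
  exact h3.trans ((summable_layer hq0 hq1 hr hrc x).le_tsum ⌊x⌋
    fun d _ => (layer_pos q r c _).le)

/-- The limit of the `k`-th moment, as a function of `log_Q n`. -/
noncomputable def momentLimit (q : ℝ) (b k : ℕ) (x : ℝ) : ℝ :=
  1 + ∑ j ∈ Finset.Ico 1 k, (Nat.stirlingSecond k j : ℝ) * (((1 / q) ^ (k - j) - 1) *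
    periodSum q (k - j) (b - j) x)

/-- The Fourier coefficients of `momentLimit`, up to the constant `1`. -/
noncomputable def momentCoeff (q : ℝ) (b k : ℕ) (l : ℤ) : ℂ :=
  ∑ j ∈ Finset.Ico 1 k, (Nat.stirlingSecond k j : ℂ) * (((1 / q : ℝ) ^ (k - j) - 1 : ℝ) *
    layerCoeff q (k - j) (b - j) l)

lemma one_div_pow_sub_one_nonneg (hq0 : 0 < q) (hq1 : q < 1) (r : ℕ) : 0 ≤ (1 / q) ^ r - 1 := by
  rw [sub_nonneg]
  exact one_le_pow₀ (by rw [one_div]; exact (one_le_inv₀ hq0).2 hq1.le)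

lemma one_le_momentLimit (hq0 : 0 < q) (hq1 : q < 1) (b k : ℕ) (x : ℝ) :
    1 ≤ momentLimit q b k x := by
  rw [momentLimit, le_add_iff_nonneg_right]
  exact Finset.sum_nonneg fun j _ => mul_nonneg (Nat.cast_nonneg _)
    (mul_nonneg (one_div_pow_sub_one_nonneg hq0 hq1 _) (periodSum_nonneg _ _ _ _))

lemma zpow_sub_eq (q : ℝ) {j k : ℕ} (hjk : j < k) :
    q ^ ((j : ℤ) - (k : ℤ)) = (1 / q) ^ (k - j) := by
  rw [one_div, inv_pow, ← zpow_natCast, ← zpow_neg, Nat.cast_sub hjk.le, neg_sub]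

variable {b k : ℕ}

/-- With r = k - j and c = b - j one has c - r = b - k, and the minus sign of
`layerCoeff_of_ne_zero` turns Q^r - 1 into 1 - q^(j-k). -/
lemma wTerm_eq (hq0 : 0 < q) (hq1 : q < 1) (hkb : k ≤ b) (x : ℝ) {l : ℤ} (hl : l ≠ 0) :
    wTerm q b k x l =
      momentCoeff q b k l * Complex.exp (-(2 * l * Real.pi * Complex.I * x)) := by
  rw [wTerm, momentCoeff]
  congr 1
  rw [Finset.mul_sum]
  refine Finset.sum_congr rfl fun j hj => ?_
  obtain ⟨hj1, hjk⟩ := Finset.mem_Ico.1 hj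
  rw [layerCoeff_of_ne_zero hq0 hq1 (by omega) (by omega) hl]
  have h1 : (q : ℂ) ^ ((j : ℤ) - (k : ℤ)) = (((1 / q) ^ (k - j) : ℝ) : ℂ) := by
    rw [← zpow_sub_eq q hjk]; push_cast; rfl
  have h2 : -((k - j : ℕ) : ℂ) = (j : ℂ) - k := by
    rw [Nat.cast_sub hjk.le]; ring
  have h3 : ((b - j : ℕ) : ℂ) - ((k - j : ℕ) : ℂ) = (b : ℂ) - k := by
    rw [Nat.cast_sub hjk.le, Nat.cast_sub (hjk.le.trans hkb)]; ring
  rw [h1, h2, h3]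
  push_cast
  ring

lemma summable_momentCoeff (hq0 : 0 < q) (hq1 : q < 1) (hkb : k ≤ b) :
    Summable (momentCoeff q b k) :=
  summable_sum fun j hj => by
    obtain ⟨hj1, hjk⟩ := Finset.mem_Ico.1 hj
    exact ((summable_layerCoeff hq0 hq1 (by omega) (by omega)).mul_left _).mul_left _

lemma hasSum_momentCoeff (hq0 : 0 < q) (hq1 : q < 1) (hkb : k ≤ b) (x : ℝ) :
    HasSum (fun l : ℤ => momentCoeff q b k l * Complex.exp (-(2 * l * Real.pi * Complex.I * x)))
      ((momentLimit q b k x - 1 : ℝ) : ℂ) := by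
  have h : ((momentLimit q b k x - 1 : ℝ) : ℂ) = ∑ j ∈ Finset.Ico 1 k,
      (Nat.stirlingSecond k j : ℂ) * (((1 / q : ℝ) ^ (k - j) - 1 : ℝ) *
        (periodSum q (k - j) (b - j) x : ℂ)) := by
    rw [momentLimit, add_sub_cancel_left]
    push_cast
    rfl
  rw [h]
  simp only [momentCoeff, Finset.sum_mul]
  refine hasSum_sum fun j hj => ?_
  obtain ⟨hj1, hjk⟩ := Finset.mem_Ico.1 hj
  simp only [mul_assoc]
  have := hasSum_layerCoeff (r := k - j) (c := b - j) hq0 hq1 (by omega) (by omega) x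
  simp only [mul_assoc] at this
  exact (this.mul_left _).mul_left _

lemma one_add_momentCoeff_zero (hq0 : 0 < q) (hq1 : q < 1) (hkb : k ≤ b) :
    1 + momentCoeff q b k 0 = (m q b k : ℂ) := by
  rw [momentCoeff, m, Finset.mul_sum]
  push_cast
  congr 1
  refine Finset.sum_congr rfl fun j hj => ?_
  obtain ⟨hj1, hjk⟩ := Finset.mem_Ico.1 hj
  rw [layerCoeff_zero hq0 hq1 (by omega) (by omega), show b - j - (k - j) = b - k by omega]
  have h1 : (q : ℂ) ^ ((j : ℤ) - (k : ℤ)) = (1 / q : ℂ) ^ (k - j) := by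
    have := congrArg (fun t : ℝ => (t : ℂ)) (zpow_sub_eq q hjk)
    push_cast at this
    exact this
  rw [h1]
  push_cast [Nat.cast_sub hjk.le]
  have h2 : (L q : ℂ) ≠ 0 := by exact_mod_cast (L_pos hq0 hq1).ne'
  have h3 : ((b - j)! : ℂ) ≠ 0 := by exact_mod_cast Nat.factorial_ne_zero _
  have h4 : (k : ℂ) - j ≠ 0 := sub_ne_zero.2 (by exact_mod_cast hjk.ne')
  field_simp

lemma summable_wTerm (hq0 : 0 < q) (hq1 : q < 1) (hkb : k ≤ b) (x : ℝ) :
    Summable fun l : {l : ℤ // l ≠ 0} => wTerm q b k x l := by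
  refine ((hasSum_momentCoeff hq0 hq1 hkb x).summable.subtype {l | l ≠ 0}).congr fun l => ?_
  exact (wTerm_eq hq0 hq1 hkb x l.2).symm

/-- Splits off the Fourier coefficient l = 0. In particular w takes real values, although defined in
ℂ. -/
lemma m_add_w (hq0 : 0 < q) (hq1 : q < 1) (hkb : k ≤ b) (x : ℝ) :
    (m q b k : ℂ) + w q b k x = (momentLimit q b k x : ℂ) := by
  have h := hasSum_momentCoeff hq0 hq1 hkb x
  have h1 := h.summable.tsum_subtype_add_tsum_subtype_compl {0}
  rw [h.tsum_eq, tsum_singleton (0 : ℤ) (fun l : ℤ => momentCoeff q b k l *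
    Complex.exp (-(2 * l * Real.pi * Complex.I * x)))] at h1
  have h2 : w q b k x = ∑' l : (({0} : Set ℤ)ᶜ : Set ℤ), momentCoeff q b k l *
      Complex.exp (-(2 * (l : ℤ) * Real.pi * Complex.I * x)) :=
    tsum_congr fun l => wTerm_eq hq0 hq1 hkb x l.2
  rw [← h2] at h1
  rw [← one_add_momentCoeff_zero hq0 hq1 hkb]
  have h3 : momentCoeff q b k 0 + w q b k x = ((momentLimit q b k x - 1 : ℝ) : ℂ) := by
    rw [← h1]; simp
  rw [add_assoc, h3]
  push_cast
  ring

lemma norm_wTerm (hq0 : 0 < q) (hq1 : q < 1) (hkb : k ≤ b) (x : ℝ) {l : ℤ} (hl : l ≠ 0) :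
    ‖wTerm q b k x l‖ = ‖momentCoeff q b k l‖ := by
  rw [wTerm_eq hq0 hq1 hkb x hl, norm_mul, norm_exp_neg_two_mul, mul_one]

lemma summable_norm_momentCoeff_subtype (hq0 : 0 < q) (hq1 : q < 1) (hkb : k ≤ b) :
    Summable fun l : {l : ℤ // l ≠ 0} => ‖momentCoeff q b k l‖ :=
  (summable_momentCoeff hq0 hq1 hkb).norm.subtype {l | l ≠ 0}

lemma continuous_wTerm (q : ℝ) (b k : ℕ) (l : ℤ) : Continuous fun x => wTerm q b k x l := by
  unfold wTerm
  fun_prop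

lemma continuous_w (hq0 : 0 < q) (hq1 : q < 1) (hkb : k ≤ b) : Continuous (w q b k) :=
  continuous_tsum (fun l => continuous_wTerm q b k l)
    (summable_norm_momentCoeff_subtype hq0 hq1 hkb)
    fun l x => (norm_wTerm hq0 hq1 hkb x l.2).le

lemma periodic_w (q : ℝ) (b k : ℕ) : Function.Periodic (w q b k) 1 := by
  intro x
  refine tsum_congr fun l => ?_
  rw [wTerm, wTerm]
  congr 1
  rw [← mul_one (Complex.exp (-(2 * (l : ℤ) * Real.pi * Complex.I * x))),
    ← exp_neg_two_mul_intCast l, ← Complex.exp_add]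
  congr 1
  push_cast
  ring

lemma integral_wTerm (q : ℝ) (b k : ℕ) {l : ℤ} (hl : l ≠ 0) :
    ∫ x in (0 : ℝ)..1, wTerm q b k x l = 0 := by
  have hc : -(2 * (l : ℂ) * Real.pi * Complex.I) ≠ 0 := by
    simp [hl, Real.pi_ne_zero]
  have h := integral_exp_mul_complex (a := 0) (b := 1) hc
  rw [Complex.ofReal_one, mul_one, exp_neg_two_mul_intCast, Complex.ofReal_zero, mul_zero,
    Complex.exp_zero, sub_self, zero_div] at h
  simp only [wTerm]
  rw [intervalIntegral.integral_const_mul]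
  simp only [← neg_mul] at h ⊢
  rw [h, mul_zero]

lemma integral_w (hq0 : 0 < q) (hq1 : q < 1) (hkb : k ≤ b) :
    ∫ x in (0 : ℝ)..1, w q b k x = 0 := by
  have h := intervalIntegral.hasSum_integral_of_dominated_convergence (μ := volume) (a := 0) (b := 1)
    (F := fun (l : {l : ℤ // l ≠ 0}) x => wTerm q b k x l) (f := w q b k)
    (fun l _ => ‖momentCoeff q b k l‖)
    (fun l => (continuous_wTerm q b k l).aestronglyMeasurable)
    (fun l => ae_of_all _ fun x _ => (norm_wTerm hq0 hq1 hkb x l.2).le)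
    (ae_of_all _ fun _ _ => summable_norm_momentCoeff_subtype hq0 hq1 hkb)
    intervalIntegrable_const
    (ae_of_all _ fun x _ => (summable_wTerm hq0 hq1 hkb x).hasSum)
  have h0 : ∀ l : {l : ℤ // l ≠ 0}, ∫ x in (0 : ℝ)..1, wTerm q b k x l = 0 := fun l =>
    integral_wTerm q b k l.2
  simp only [h0] at h
  exact h.unique hasSum_zero

end Periodic

/-! ### Asymptotic equivalence -/

section Asymptotic

variable {q : ℝ} {b k : ℕ}

/-- The closed form of the `k`-th moment is asymptotic to the periodic limit. -/
lemma tendsto_moment_sub_momentLimit (hq0 : 0 < q) (hq1 : q < 1) (hk : 1 ≤ k) (hkb : k ≤ b) :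
    Tendsto (fun n : ℕ => (∑ j ∈ Finset.range (k + 1), (Nat.stirlingSecond k j : ℝ) *
      ((n.descFactorial j : ℝ) *
        (((1 / q) ^ (k - j) - 1) * depthSum q (k - j) (n - j) (b - j) + 1))) / (n : ℝ) ^ k -
      momentLimit q b k (Real.logb (1 / q) n)) atTop (𝓝 0) := by
  have hterm : ∀ j ∈ Finset.Ico 1 k, Tendsto (fun n : ℕ => (Nat.stirlingSecond k j : ℝ) *
      (((1 / q) ^ (k - j) - 1) * ((n.descFactorial j : ℝ) / (n : ℝ) ^ j *
          (depthSum q (k - j) (n - j) (b - j) / (n : ℝ) ^ (k - j)) -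
          1 * periodSum q (k - j) (b - j) (Real.logb (1 / q) n)) +
        (n.descFactorial j : ℝ) / (n : ℝ) ^ j * (1 / (n : ℝ) ^ (k - j)))) atTop (𝓝 0) := by
    intro j hj
    obtain ⟨hj1, hjk⟩ := Finset.mem_Ico.1 hj
    have h1 := tendsto_mul_sub_mul (tendsto_descFactorial_div_pow j)
      (tendsto_depthSum_sub_periodSum (r := k - j) (c := b - j) hq0 hq1 (by omega) (by omega) j)
      (fun n => periodSum_le hq0 hq1 (by omega) (by omega) _)
    have h2 : Tendsto (fun n : ℕ => 1 / (n : ℝ) ^ (k - j)) atTop (𝓝 0) :=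
      tendsto_const_nhds.div_atTop
        ((tendsto_pow_atTop (by omega)).comp tendsto_natCast_atTop_atTop)
    have h3 := ((h1.const_mul ((1 / q) ^ (k - j) - 1)).add
      ((tendsto_descFactorial_div_pow j).mul h2)).const_mul (Nat.stirlingSecond k j : ℝ)
    simpa using h3
  have hsum := (tendsto_finsetSum _ hterm).add ((tendsto_descFactorial_div_pow k).sub_const 1)
  simp only [Finset.sum_const_zero, sub_self, add_zero] at hsum
  refine hsum.congr' ?_
  filter_upwards [eventually_gt_atTop 0] with n hn
  have hn' : (n : ℝ) ≠ 0 := by exact_mod_cast hn.ne'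
  -- Since k ≥ 1 there is no term j = 0. In the term j = k the factor Q^0 - 1 vanishes, and what
  -- remains tends to 1, the constant in `momentLimit`.
  have h0 : Nat.stirlingSecond k 0 = 0 := by
    obtain ⟨t, rfl⟩ : ∃ t, k = t + 1 := ⟨k - 1, by omega⟩
    exact Nat.stirlingSecond_succ_zero t
  rw [Finset.sum_range_succ, Finset.range_eq_Ico, Finset.sum_eq_sum_Ico_succ_bot (a := 0) (b := k) (by omega),
    momentLimit, h0, Nat.stirlingSecond_self, Nat.cast_zero, zero_mul, zero_add, Nat.sub_self,
    pow_zero, sub_self, zero_mul, zero_add, zero_add, mul_one, Nat.cast_one, one_mul, add_div,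
    add_comm (1 : ℝ), add_sub_add_comm, Finset.sum_div]
  rw [← Finset.sum_sub_distrib]
  congr 1
  refine Finset.sum_congr rfl fun j hj => ?_
  obtain ⟨hj1, hjk⟩ := Finset.mem_Ico.1 hj
  have hpow : (n : ℝ) ^ k = (n : ℝ) ^ j * (n : ℝ) ^ (k - j) := by
    rw [← pow_add, Nat.add_sub_cancel' hjk.le]
  rw [hpow]
  have hnj : (n : ℝ) ^ j ≠ 0 := pow_ne_zero _ hn'
  have hnk : (n : ℝ) ^ (k - j) ≠ 0 := pow_ne_zero _ hn'
  field_simp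
  ring

lemma isEquivalent_ofReal_of_tendsto_sub {f g : ℕ → ℝ} {δ : ℝ} (hδ : 0 < δ) (hg : ∀ n, δ ≤ g n)
    (h : Tendsto (fun n => f n - g n) atTop (𝓝 0)) :
    (fun n => (f n : ℂ)) ~[atTop] fun n => (g n : ℂ) := by
  have h1 : (fun n => f n - g n) =o[atTop] fun _ => (1 : ℝ) := (isLittleO_one_iff ℝ).2 h
  have h2 : (fun _ : ℕ => (1 : ℝ)) =O[atTop] g := by
    refine IsBigO.of_bound (1 / δ) (Eventually.of_forall fun n => ?_)
    have := hg n
    rw [norm_one, Real.norm_eq_abs, abs_of_pos (hδ.trans_le this), one_div_mul_eq_div,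
      le_div_iff₀ hδ, one_mul]
    exact this
  have h3 := h1.trans_isBigO h2
  rw [IsEquivalent]
  refine IsLittleO.of_norm_norm ?_
  refine h3.norm_norm.congr (fun n => ?_) fun n => ?_
  · rw [Pi.sub_apply, ← Complex.ofReal_sub, Complex.norm_real]
  · rw [Complex.norm_real]

lemma momentLimit_one (q : ℝ) (b : ℕ) (x : ℝ) : momentLimit q b 1 x = 1 := by
  simp [momentLimit]

/-- For the variance the limit 1 of the squared mean is subtracted, so the bound
`one_le_momentLimit` no longer suffices. -/
lemma exists_pos_le_momentLimit_two_sub_one (hq0 : 0 < q) (hq1 : q < 1) (hb : 2 ≤ b) :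
    ∃ δ > 0, ∀ x, δ ≤ momentLimit q b 2 x - 1 := by
  obtain ⟨δ, hδ, h⟩ := exists_pos_le_periodSum hq0 hq1 (r := 1) (c := b - 1) le_rfl (by omega)
  have hQ : 0 < 1 / q - 1 := by
    rw [sub_pos, one_div]
    exact (one_lt_inv₀ hq0).2 hq1
  refine ⟨(1 / q - 1) * δ, mul_pos hQ hδ, fun x => ?_⟩
  have h1 : momentLimit q b 2 x - 1 = (1 / q - 1) * periodSum q 1 (b - 1) x := by
    simp [momentLimit, Nat.stirlingSecond_one_right]
  rw [h1]
  exact mul_le_mul_of_nonneg_left (h x) hQ.le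

lemma m_two_sub_one {p : ℝ} (hq0 : 0 < q) (hq1 : q < 1) (hpq : q = 1 - p) (hb : 2 ≤ b) :
    m q b 2 - 1 = p / (((b : ℝ) - 1) * q * L q) := by
  obtain ⟨c, rfl⟩ := Nat.exists_eq_add_of_le' hb
  have hL := (L_pos hq0 hq1).ne'
  have hc : (c ! : ℝ) ≠ 0 := by positivity
  have hc1 : (c : ℝ) + 1 ≠ 0 := by positivity
  have h1 : m q (c + 2) 2 = 1 + (c ! : ℝ) / L q * ((1 / q - 1) / ((c + 1) * c !)) := by
    have h2 := zpow_sub_eq q (show 1 < 2 by norm_num)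
    have h3 : Nat.stirlingSecond 2 1 = 1 := Nat.stirlingSecond_one_right 1
    have h4 : (c + 2 - 1)! = (c + 1) * c ! := Nat.factorial_succ c
    norm_num at h2
    rw [m, Nat.add_sub_cancel, show Finset.Ico 1 2 = {1} from rfl, Finset.sum_singleton, h3, h4]
    norm_num [h2]
  obtain rfl : p = 1 - q := by linarith
  rw [h1, add_sub_cancel_left]
  push_cast
  have hc2 : (c : ℝ) + 2 - 1 = c + 1 := by ring
  rw [hc2]
  have hq0' := hq0.ne'
  field_simp

end Asymptotic

end AdaptiveSampling

theorem mainTheorem10 {Ω : Type*} [MeasurableSpace Ω] (μ : Measure Ω) [IsProbabilityMeasure μ]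
    {K : Type*} [DecidableEq K] (p q : ℝ) (hp0 : 0 < p) (hp1 : p < 1) (hq : q = 1 - p)
    (b : ℕ)
    -- `H x j` is the `j`-th bit of the hashed value of the key `x`
    (H : K → ℕ → Ω → Bool) (hmeas : ∀ x j, Measurable (H x j))
    (hindep : iIndepFun (fun i : K × ℕ => H i.1 i.2) μ)
    (hlaw : ∀ x j, μ {ω | H x j ω = true} = ENNReal.ofReal p)
    -- `S n` is a stream of data with exactly `n` distinct keys
    (S : ℕ → List K) (hS : ∀ n, (S n).toFinset.card = n)
    (Zn : ℕ → Ω → ℝ)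
    (hZn : ∀ n ω, Zn n ω = AdaptiveSampling.Z q b (fun x j => H x j ω) (S n)) :
    (∀ k : ℕ, 1 ≤ k → k ≤ b →
      (∀ n, Integrable (fun ω => Zn n ω ^ k) μ) ∧
      (∀ x : ℝ, Summable fun l : {l : ℤ // l ≠ 0} => AdaptiveSampling.wTerm q b k x l) ∧
      Continuous (AdaptiveSampling.w q b k) ∧
      Function.Periodic (AdaptiveSampling.w q b k) 1 ∧
      ∫ x in (0 : ℝ)..1, AdaptiveSampling.w q b k x = 0 ∧
      (fun n : ℕ => ((∫ ω, Zn n ω ^ k ∂μ : ℝ) : ℂ)) ~[atTop]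
        (fun n : ℕ => (AdaptiveSampling.m q b k : ℂ) +
          AdaptiveSampling.w q b k (Real.logb (1 / q) n))) ∧
    (2 ≤ b →
      (∀ n, MemLp (Zn n) 2 μ) ∧
      (fun n : ℕ => ((variance (Zn n) μ : ℝ) : ℂ)) ~[atTop]
        (fun n : ℕ => ((p / (((b : ℝ) - 1) * q * AdaptiveSampling.L q) : ℝ) : ℂ) +
          AdaptiveSampling.w q b 2 (Real.logb (1 / q) n))) := by
  have hq0 : 0 < q := by linarith
  have hq1 : q < 1 := by linarith
  obtain rfl : Zn = fun n ω => AdaptiveSampling.Z q b (fun x j => H x j ω) (S n) := by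
    ext n ω
    exact hZn n ω
  have hlim : ∀ k : ℕ, 1 ≤ k → k ≤ b → Tendsto (fun n : ℕ =>
      ∫ ω, AdaptiveSampling.Z q b (fun x j => H x j ω) (S n) ^ k ∂μ -
        AdaptiveSampling.momentLimit q b k (Real.logb (1 / q) n)) atTop (𝓝 0) := by
    intro k hk hkb
    refine (AdaptiveSampling.tendsto_moment_sub_momentLimit hq0 hq1 hk hkb).congr' ?_
    -- The exact moment formula requires overflow, which holds as soon as n > b.
    filter_upwards [eventually_gt_atTop b] with n hn
    rw [(AdaptiveSampling.integral_Z_pow hp0 hp1 hq hmeas hindep hlaw (S n) (hS n) hkb hn).2]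
  have hint : ∀ k : ℕ, k ≤ b → ∀ n, Integrable (fun ω =>
      AdaptiveSampling.Z q b (fun x j => H x j ω) (S n) ^ k) μ := fun k hkb n =>
    AdaptiveSampling.integrable_Z_pow hp0 hp1 hq hmeas hindep hlaw (S n) hkb
  refine ⟨fun k hk hkb => ⟨hint k hkb, AdaptiveSampling.summable_wTerm hq0 hq1 hkb,
    AdaptiveSampling.continuous_w hq0 hq1 hkb, AdaptiveSampling.periodic_w q b k,
    AdaptiveSampling.integral_w hq0 hq1 hkb, ?_⟩, fun hb => ?_⟩
  · simp only [AdaptiveSampling.m_add_w hq0 hq1 hkb]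
    exact AdaptiveSampling.isEquivalent_ofReal_of_tendsto_sub one_pos
      (fun n => AdaptiveSampling.one_le_momentLimit hq0 hq1 b k _) (hlim k hk hkb)
  · have hmem : ∀ n, MemLp (fun ω => AdaptiveSampling.Z q b (fun x j => H x j ω) (S n)) 2 μ := by
      intro n
      have h1 := hint 1 (by omega) n
      simp only [pow_one] at h1
      exact (memLp_two_iff_integrable_sq h1.aestronglyMeasurable).2 (hint 2 hb n)
    refine ⟨hmem, ?_⟩
    obtain ⟨δ, hδ, hle⟩ := AdaptiveSampling.exists_pos_le_momentLimit_two_sub_one hq0 hq1 hb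
    have hrhs : ∀ x : ℝ, ((p / (((b : ℝ) - 1) * q * AdaptiveSampling.L q) : ℝ) : ℂ) +
        AdaptiveSampling.w q b 2 x =
        ((AdaptiveSampling.momentLimit q b 2 x - 1 : ℝ) : ℂ) := by
      intro x
      rw [← AdaptiveSampling.m_two_sub_one hq0 hq1 hq hb, Complex.ofReal_sub, Complex.ofReal_sub,
        ← AdaptiveSampling.m_add_w hq0 hq1 hb x]
      ring
    simp only [hrhs]
    refine AdaptiveSampling.isEquivalent_ofReal_of_tendsto_sub hδ (fun n => hle _) ?_
    have h1 := hlim 1 le_rfl (by omega)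
    have h2 := hlim 2 (by omega) hb
    simp only [AdaptiveSampling.momentLimit_one, pow_one] at h1
    have h3 : Tendsto (fun n : ℕ =>
        ∫ ω, AdaptiveSampling.Z q b (fun x j => H x j ω) (S n) ∂μ) atTop (𝓝 1) := by
      simpa using h1.add_const 1
    -- V(Z) = E[Z²] - E[Z]² with E[Z] → 1.
    have h4 := h2.sub ((h3.pow 2).sub_const 1)
    simp only [one_pow, sub_self] at h4
    refine h4.congr fun n => ?_
    rw [variance_eq_sub (hmem n)]
    simp only [Pi.pow_apply]
    ring
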